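/- \textbf{Setting.} Let $A\in\mathbb R^{n_x\times n_x}$, $B_d\in\mathbb R^{n_x\times n_d}$, $B_u\in\mathbb R^{n_x\times n_u}$, $C_e\in\mathbb R^{n_e\times n_x}$, $D_{eu}\in\mathbb R^{n_e\times n_u}$ be the data of the plant $x_{t+1}=Ax_t+B_dd_t+B_uu_t$, $e_t=C_ex_t+D_{eu}u_t$ ($t\in\mathbb Z$), and put $Q=C_e^\top C_e$, $S=C_e^\top D_{eu}$, $R=D_{eu}^\top D_{eu}$. A real square matrix is \emph{Schur} if its spectral radius is less than $1$; $(M,N)$ is \emph{stabilizable} if $M-NK$ is Schur for some real $K$. A \emph{stabilizing solution} of the discrete-time algebraic Riccati equation (DARE) with data $(A,B,Q,R,S)$ is a matrix $X\succeq 0$ with $$0=X-A^\top XA-Q+(A^\top XB+S)(R+B^\top XB)^{-1}(A^\top XB+S)^\top$$ such that $A-BK$ is Schur, where $K=(R+B^\top XB)^{-1}(A^\top XB+S)^\top$. Let $\ell_2$ be the space of two-sided real vector sequences with $\|d\|^2=\sum_{t\in\mathbb Z}d_t^\top d_t<\infty$. A real state-space system $x_{t+1}=Ax_t+Bd_t$,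 $e_t=Cx_t+Dd_t$, run forward from $x_{-\infty}=0$, is called \emph{stable} if $A$ is Schur, and \emph{causal} if its output up to each time $T$ depends only on the input up to time $T$. \textbf{Assumptions.} Let $\gamma_d>0$, $\gamma_J\ge0$, and assume: (i) $R\succ0$; (ii) $(A,B_u)$ is stabilizable; (iii) $A-B_uR^{-1}S^\top$ is nonsingular; (iv) $\begin{bmatrix}A-e^{j\theta}I&B_u\\C_e&D_{eu}\end{bmatrix}$ has full column rank for every $\theta\in[0,2\pi]$. \textbf{Conclusion.} The DARE with data $(A,B_u,Q,R,S)$ has a unique stabilizing solution $X\succeq0$. Put $H=R+B_u^\top XB_u$, $K_x=H^{-1}(A^\top XB_u+S)^\top$, $K_v=H^{-1}B_u^\top$, $K_d=H^{-1}B_u^\top XB_d$, $\hat A_{11}=A-B_uK_x$; then $\hat A_{11}$ is nonsingular. The non-causal controller $K^o$ is $$v_t=\hat A_{11}^\top(v_{t+1}+XB_dd_t),\quad v_\infty=0,\qquad u_t=-K_xx_t-K_vv_{t+1}-K_dd_t .$$ Assume in addition that $(\hat A_{11}^{-\top},XB_d)$ is stabilizable. Then: (a) For every $d\in\ell_2$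 the closed loop of the plant (with $x_{-\infty}=0$) and $K^o$ has exactly one solution $(x,v,u,e^o)$. The sequence $\hat e_t=\begin{bmatrix}\gamma_Je^o_t\\\gamma_dd_t\end{bmatrix}$ is in $\ell_2$ and is the unique output, under the boundary conditions $\hat x_{-\infty}=\hat x_\infty=0$, of the system $\hat x_{t+1}=\hat A\hat x_t+\hat Bd_t$, $\hat e_t=\hat C\hat x_t+\hat Dd_t$ with $$\hat A=\begin{bmatrix}\hat A_{11}&-B_uK_v\hat A_{11}^{-\top}\\0&\hat A_{11}^{-\top}\end{bmatrix},\ \hat B=\begin{bmatrix}B_d\\-XB_d\end{bmatrix},\ \hat C=\gamma_J\begin{bmatrix}C_e-D_{eu}K_x&-D_{eu}K_v\hat A_{11}^{-\top}\\0&0\end{bmatrix},\ \hat D=\gamma_d\begin{bmatrix}0\\I\end{bmatrix}.$$ (b) There is an $n_d\times n_d$ linear time-invariant real state-space system $F$ with state dimension $n_x$ such that $\|\hat e\|^2=\|Fd\|^2$ for all $d\in\ell_2$; $F$ is stable, causal and invertible on $\ell_2$, and its inverse $F^{-1}$ is again an $n_d\times n_d$ stable causal state-space system (also realizable with state dimension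 $n_x$). Both $F$ and $F^{-1}$ map $\ell_2$ into $\ell_2$. (c) $X$ is positive definite, in particular nonsingular. The DARE with data $(\hat A_{11}^{-\top},\,XB_d,\,\tilde Q,\,\gamma_d^2I,\,0)$, where $$\tilde Q=\gamma_J^2\hat A_{11}^{-1}\bigl(X^{-1}-\hat A_{11}X^{-1}\hat A_{11}^\top-B_uH^{-1}B_u^\top\bigr)\hat A_{11}^{-\top},$$ has a unique stabilizing solution $V\succeq0$, and the unique stabilizing solution of the DARE with data $(\hat A,\hat B,\hat C^\top\hat C,\hat D^\top\hat D,\hat C^\top\hat D)$ is $$\hat X=\gamma_J^2\begin{bmatrix}X&I\\I&X^{-1}\end{bmatrix}+\begin{bmatrix}0&0\\0&V\end{bmatrix}.$$ -/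

import Mathlib

open Matrix Filter Topology

namespace RegretControl

noncomputable section

/-! ### Signals: two-sided sequences of real vectors -/

/-- `v : ℤ → ℝⁿ` belongs to `ℓ₂`, i.e. `⟨v, v⟩ = ∑ₜ vₜᵀ vₜ` is finite. -/
def IsL2 {n : Type*} [Fintype n] (v : ℤ → n → ℝ) : Prop :=
  Summable fun t => v t ⬝ᵥ v t

/-- The squared `ℓ₂` norm `‖v‖² = ⟨v, v⟩ = ∑ₜ vₜᵀ vₜ` (meaningful when `IsL2 v`). -/
def normSq {n : Type*} [Fintype n] (v : ℤ → n → ℝ) : ℝ :=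
  ∑' t, v t ⬝ᵥ v t

/-- The truncation operator `P_T`. -/
def trunc {n : Type*} (T : ℤ) (v : ℤ → n → ℝ) : ℤ → n → ℝ :=
  fun t => if t ≤ T then v t else 0

/-! ### Matrices -/

/-- A real square matrix is Schur stable: its spectral radius (over `ℂ`) is less than one. -/
def IsSchur {n : Type*} [Fintype n] [DecidableEq n] (A : Matrix n n ℝ) : Prop :=
  spectralRadius ℂ (A.map Complex.ofReal) < 1

/-- The pair `(A, B)` is stabilizable (discrete time). -/
def Stabilizable {n m : Type*} [Fintype n] [DecidableEq n] [Fintype m]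
    (A : Matrix n n ℝ) (B : Matrix n m ℝ) : Prop :=
  ∃ K : Matrix m n ℝ, IsSchur (A - B * K)

/-! ### Discrete-time algebraic Riccati equations -/

/-- The gain `(R + Bᵀ X B)⁻¹ (Aᵀ X B + S)ᵀ`. -/
def dareGain {n m : Type*} [Fintype n] [Fintype m] [DecidableEq m]
    (A : Matrix n n ℝ) (B : Matrix n m ℝ) (R : Matrix m m ℝ) (S : Matrix n m ℝ)
    (X : Matrix n n ℝ) : Matrix m n ℝ :=
  (R + Bᵀ * X * B)⁻¹ * (Aᵀ * X * B + S)ᵀ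

/-- `X ⪰ 0` is a stabilizing solution of the DARE with data `(A, B, Q, R, S)`. The matrix
`R + Bᵀ X B` is positive definite wherever this is used, since `R` is. -/
structure IsStabilizingSolution {n m : Type*} [Fintype n] [DecidableEq n] [Fintype m]
    [DecidableEq m] (A : Matrix n n ℝ) (B : Matrix n m ℝ) (Q : Matrix n n ℝ)
    (R : Matrix m m ℝ) (S : Matrix n m ℝ) (X : Matrix n n ℝ) : Prop where
  posSemidef : X.PosSemidef
  dare : 0 = X - Aᵀ * X * A - Q
    + (Aᵀ * X * B + S) * (R + Bᵀ * X * B)⁻¹ * (Aᵀ * X * B + S)ᵀ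
  schur : IsSchur (A - B * dareGain A B R S X)

/-! ### Linear time-invariant systems in state-space form -/

/-- State-space data `x_{t+1} = A x_t + B d_t`, `e_t = C x_t + D d_t`, with coordinates of the
state, input and output indexed by `n`, `m` and `p`. -/
structure LTI (n m p : Type*) where
  A : Matrix n n ℝ
  B : Matrix n m ℝ
  C : Matrix p n ℝ
  D : Matrix p m ℝ

namespace LTI

variable {n m p : Type*} [Fintype n] [Fintype m] [Fintype p]

/-- The signals `d` (input), `x` (state), `e` (output) satisfy the system equations. -/
def Trajectory (G : LTI n m p) (d : ℤ → m → ℝ) (x : ℤ → n → ℝ) (e : ℤ → p → ℝ) : Prop :=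
  (∀ t, x (t + 1) = G.A *ᵥ x t + G.B *ᵥ d t) ∧ (∀ t, e t = G.C *ᵥ x t + G.D *ᵥ d t)

/-- `e = G d`, the system being run forward from the initial condition `x_{-∞} = 0`. -/
def Maps (G : LTI n m p) (d : ℤ → m → ℝ) (e : ℤ → p → ℝ) : Prop :=
  ∃ x, G.Trajectory d x e ∧ Tendsto x atBot (𝓝 0)

/-- `e` is the output of `G` for the input `d` under the two boundary conditions `x_{-∞} = 0` and
`x_∞ = 0`; this is how a system with stable non-causal dynamics acts. -/
def MapsTwoSided (G : LTI n m p) (d : ℤ → m → ℝ) (e : ℤ → p → ℝ) : Prop :=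
  ∃ x, G.Trajectory d x e ∧ Tendsto x atBot (𝓝 0) ∧ Tendsto x atTop (𝓝 0)

/-- Stability of a system run forward in time: the state matrix is Schur. -/
def IsStable [DecidableEq n] (G : LTI n m p) : Prop := IsSchur G.A

/-- `G`, run forward in time, is a (single-valued, everywhere defined) operator `ℓ₂ → ℓ₂`. -/
def IsL2Operator (G : LTI n m p) : Prop :=
  ∀ d, IsL2 d → ∃ e, IsL2 e ∧ ∀ e', G.Maps d e' ↔ e' = e

/-- Causality: `P_T G d = P_T G P_T d`. -/
def IsCausal (G : LTI n m p) : Prop :=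
  ∀ (T : ℤ) (d : ℤ → m → ℝ) (e e' : ℤ → p → ℝ), IsL2 d → G.Maps d e → G.Maps (trunc T d) e' →
    trunc T e = trunc T e'

/-- `G` is the inverse system of `F` on `ℓ₂` : `e = F d` if and only if `d = G e`. -/
def IsInverse {q : Type*} [Fintype q] (F : LTI n m m) (G : LTI q m m) : Prop :=
  ∀ d e, IsL2 d → IsL2 e → (F.Maps d e ↔ G.Maps e d)

end LTI

/-! ### The plant and the non-causal controller -/

/-- The part of the plant that the full-information problem uses:
`x_{t+1} = A x_t + B_d d_t + B_u u_t`, `e_t = C_e x_t + D_eu u_t`. -/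
structure Plant (nx nd nu ne : ℕ) where
  A : Matrix (Fin nx) (Fin nx) ℝ
  Bd : Matrix (Fin nx) (Fin nd) ℝ
  Bu : Matrix (Fin nx) (Fin nu) ℝ
  Ce : Matrix (Fin ne) (Fin nx) ℝ
  Deu : Matrix (Fin ne) (Fin nu) ℝ

namespace Plant

variable {nx nd nu ne : ℕ} (P : Plant nx nd nu ne)

/-- `Q = C_eᵀ C_e`. -/
def Q : Matrix (Fin nx) (Fin nx) ℝ := P.Ceᵀ * P.Ce

/-- `S = C_eᵀ D_eu`. -/
def S : Matrix (Fin nx) (Fin nu) ℝ := P.Ceᵀ * P.Deu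

/-- `R = D_euᵀ D_eu`. -/
def R : Matrix (Fin nu) (Fin nu) ℝ := P.Deuᵀ * P.Deu

/-- The four standing conditions on `(A, B_u, C_e, D_eu)`. -/
structure DAREConditions : Prop where
  posDef : P.R.PosDef
  stabilizable : Stabilizable P.A P.Bu
  nonsingular : IsUnit (P.A - P.Bu * P.R⁻¹ * P.Sᵀ)
  fullRank : ∀ θ ∈ Set.Icc (0 : ℝ) (2 * Real.pi),
    (fromBlocks
      (P.A.map Complex.ofReal
        - Complex.exp (θ * Complex.I) • (1 : Matrix (Fin nx) (Fin nx) ℂ))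
      (P.Bu.map Complex.ofReal)
      (P.Ce.map Complex.ofReal)
      (P.Deu.map Complex.ofReal)).rank = nx + nu

/-- `X` is the stabilizing solution of the DARE of the plant. -/
def IsStabilizing (X : Matrix (Fin nx) (Fin nx) ℝ) : Prop :=
  IsStabilizingSolution P.A P.Bu P.Q P.R P.S X

/-- `K_x = (R + B_uᵀ X B_u)⁻¹ (Aᵀ X B_u + S)ᵀ`. -/
def Kx (X : Matrix (Fin nx) (Fin nx) ℝ) : Matrix (Fin nu) (Fin nx) ℝ :=
  dareGain P.A P.Bu P.R P.S X

/-- `K_v = (R + B_uᵀ X B_u)⁻¹ B_uᵀ`. -/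
def Kv (X : Matrix (Fin nx) (Fin nx) ℝ) : Matrix (Fin nu) (Fin nx) ℝ :=
  (P.R + P.Buᵀ * X * P.Bu)⁻¹ * P.Buᵀ

/-- `K_d = (R + B_uᵀ X B_u)⁻¹ B_uᵀ X B_d`. -/
def Kd (X : Matrix (Fin nx) (Fin nx) ℝ) : Matrix (Fin nu) (Fin nd) ℝ :=
  (P.R + P.Buᵀ * X * P.Bu)⁻¹ * P.Buᵀ * X * P.Bd

/-- `Â₁₁ = A - B_u K_x`. -/
def A11 (X : Matrix (Fin nx) (Fin nx) ℝ) : Matrix (Fin nx) (Fin nx) ℝ :=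
  P.A - P.Bu * P.Kx X

/-- The closed loop of the plant with the non-causal controller `K^o`, which runs
`v_t = (A - B_u K_x)ᵀ (v_{t+1} + X B_d d_t)` backward from `v_∞ = 0` and applies
`u_t = - K_x x_t - K_v v_{t+1} - K_d d_t`; the plant runs forward from `x_{-∞} = 0`. -/
structure ClosedLoop (X : Matrix (Fin nx) (Fin nx) ℝ) (d : ℤ → Fin nd → ℝ)
    (x v : ℤ → Fin nx → ℝ) (u : ℤ → Fin nu → ℝ) (e : ℤ → Fin ne → ℝ) : Prop where
  state : ∀ t, x (t + 1) = P.A *ᵥ x t + P.Bd *ᵥ d t + P.Bu *ᵥ u t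
  error : ∀ t, e t = P.Ce *ᵥ x t + P.Deu *ᵥ u t
  costate : ∀ t, v t = (P.A11 X)ᵀ *ᵥ (v (t + 1) + (X * P.Bd) *ᵥ d t)
  control : ∀ t, u t = -(P.Kx X *ᵥ x t) - P.Kv X *ᵥ v (t + 1) - P.Kd X *ᵥ d t
  state_init : Tendsto x atBot (𝓝 0)
  costate_final : Tendsto v atTop (𝓝 0)

/-- The closed loop with `K^o` as a system `P̂` with augmented state `(x, v)` and augmented error
`ê = (γ_J e^o, γ_d d)`. -/
def Phat (X : Matrix (Fin nx) (Fin nx) ℝ) (γd γJ : ℝ) :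
    LTI (Fin nx ⊕ Fin nx) (Fin nd) (Fin ne ⊕ Fin nd) where
  A := fromBlocks (P.A11 X) (-(P.Bu * P.Kv X * ((P.A11 X)⁻¹)ᵀ)) 0 ((P.A11 X)⁻¹)ᵀ
  B := fromRows P.Bd (-(X * P.Bd))
  C := γJ • fromBlocks (P.Ce - P.Deu * P.Kx X) (-(P.Deu * P.Kv X * ((P.A11 X)⁻¹)ᵀ)) 0 0
  D := γd • fromRows 0 1

/-- `Q̃ = γ_J² Â₁₁⁻¹ (X⁻¹ - Â₁₁ X⁻¹ Â₁₁ᵀ - B_u (R + B_uᵀ X B_u)⁻¹ B_uᵀ) Â₁₁⁻ᵀ`. -/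
def Qtilde (X : Matrix (Fin nx) (Fin nx) ℝ) (γJ : ℝ) : Matrix (Fin nx) (Fin nx) ℝ :=
  γJ ^ 2 • ((P.A11 X)⁻¹ *
    (X⁻¹ - P.A11 X * X⁻¹ * (P.A11 X)ᵀ - P.Bu * (P.R + P.Buᵀ * X * P.Bu)⁻¹ * P.Buᵀ) *
    ((P.A11 X)⁻¹)ᵀ)

end Plant

/-- `γ_J² [[X, I], [I, X⁻¹]] + diag(0, V)`. -/
def Xhat {nx : ℕ} (X V : Matrix (Fin nx) (Fin nx) ℝ) (γJ : ℝ) :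
    Matrix (Fin nx ⊕ Fin nx) (Fin nx ⊕ Fin nx) ℝ :=
  γJ ^ 2 • fromBlocks X 1 1 X⁻¹ + fromBlocks 0 0 0 V

end

end RegretControl

namespace RegretControl

/-! ### Schur matrices -/

section Schur

attribute [local instance] Matrix.linftyOpNormedRing Matrix.linftyOpNormedAlgebra
  Matrix.linftyOpNormedAddCommGroup

variable {n m : Type*} [Fintype n] [DecidableEq n] [Fintype m] [DecidableEq m]

/-! Existence for a DARE is policy iteration (`exists_isStabilizingSolution`). A stabilizing gain
has a cost matrix given by a Lyapunov equation; replacing the gain by the one optimal for that cost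
keeps the loop Schur (`isSchur_improved`) and decreases the cost. The limit solves the DARE. Its
closed loop has spectrum in the closed disc, and an eigenvalue on the circle would be an invariant
zero, which the rank condition forbids. For uniqueness, the difference of two stabilizing solutions
satisfies `Δ = A_Kᵀ Δ A_L` with both loops Schur, so `Δ = 0`.

Write `A₁` for the closed-loop matrix `P.A11 X`, `A₂` for its inverse transpose and `b = X * P.Bd`.
The augmented DARE collapses to one for `V` because `Γ = γJ² [[X, 1], [1, X⁻¹]]` annihilates the
augmented input matrix `(Bd, -b)`, while `Âᵀ Γ Â + Ĉᵀ Ĉ = Γ + diag(0, Q̃)` (`Phat_lyapunov`). Hence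
`Γ + diag(0, V)` is a solution exactly when `V` solves the reduced equation, its gain sees only the
costate, and the closed loop is block triangular with Schur diagonal blocks. The reduced equation is
solvable since `Q̃ ⪰ 0`, a dual Gram inequality (`posSemidef_inv_sub`), and since `A₂` has no
eigenvalue on the unit circle.

Summing the energy balance of the augmented DARE over all times gives `‖ê‖² = ∑ iᵀ H i`, where `i =
d - K v`, `H = γd² + bᵀ V b` and `K` is the gain of the `V` equation. The costate `v` depends on
future inputs, so this is not yet a causal factor. An observer `s` of `v` driven by `d - K s` makes
the map from `i` to `c (d - K s)` lossless (`exists_lossless_observer`). Thus `F : d ↦ c (d - K s)`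
preserves the norm, has only the state `s`, and is inverted by solving its output equation for `d`,
which gives the Schur state matrix `A₂ - b K`. -/

theorem spectralRadius_lt_one_iff (A : Matrix n n ℂ) :
    spectralRadius ℂ A < 1 ↔ ∀ (l : ℂ) (z : n → ℂ), A *ᵥ z = l • z → 1 ≤ ‖l‖ → z = 0 := by
  have hspec : ∀ l : ℂ, l ∈ spectrum ℂ A ↔ ∃ z, z ≠ 0 ∧ A *ᵥ z = l • z := by
    intro l
    rw [spectrum.mem_iff, Matrix.isUnit_iff_isUnit_det, isUnit_iff_ne_zero, not_not,
      ← Matrix.exists_mulVec_eq_zero_iff]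
    refine exists_congr fun z => and_congr_right fun _ => ?_
    rw [Matrix.sub_mulVec, sub_eq_zero, Algebra.algebraMap_eq_smul_one, Matrix.smul_mulVec,
      Matrix.one_mulVec, eq_comm]
  constructor
  · intro h l z hz hl
    by_contra hz0
    have hmem := (hspec l).2 ⟨z, hz0, hz⟩
    have h1 : (‖l‖₊ : ENNReal) ≤ spectralRadius ℂ A :=
      le_iSup₂ (f := fun k (_ : k ∈ spectrum ℂ A) => (‖k‖₊ : ENNReal)) l hmem
    have h2 : (‖l‖₊ : ENNReal) < 1 := h1.trans_lt h
    have h3 : ‖l‖₊ < 1 := by exact_mod_cast h2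
    exact absurd (NNReal.coe_lt_coe.2 h3) (by simpa using hl)
  · intro h
    -- The strict bound on the spectral radius comes from attaining it on a nonempty spectrum; for
    -- empty `n` the spectrum is empty and the radius is zero.
    rcases isEmpty_or_nonempty n with hn | hn
    · rw [spectrum.SpectralRadius.of_subsingleton]
      exact zero_lt_one
    · have := spectrum.spectralRadius_lt_of_forall_lt A (r := 1) (by
        intro k hk
        obtain ⟨z, hz0, hz⟩ := (hspec k).1 hk
        by_contra hcon
        exact hz0 (h k z hz (by simpa using NNReal.coe_le_coe.2 (not_lt.1 hcon))))
      simpa using this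

theorem isSchur_iff_eigenvector {A : Matrix n n ℝ} :
    IsSchur A ↔ ∀ (l : ℂ) (z : n → ℂ), A.map Complex.ofReal *ᵥ z = l • z → 1 ≤ ‖l‖ → z = 0 :=
  spectralRadius_lt_one_iff _

theorem map_ofReal_pow (A : Matrix n n ℝ) (k : ℕ) :
    (A ^ k).map Complex.ofReal = A.map Complex.ofReal ^ k :=
  map_pow Complex.ofRealHom.mapMatrix A k

/-- Gelfand's formula: for `r` strictly between the spectral radius and one, `‖A ^ k‖ ≤ r ^ k`
eventually. The choice of a Banach algebra norm is immaterial to the spectral radius. -/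
theorem IsSchur.summable_norm_pow {A : Matrix n n ℝ} (h : IsSchur A) :
    Summable fun k => ‖(A.map Complex.ofReal) ^ k‖ := by
  obtain ⟨r, hr, hr1⟩ := ENNReal.lt_iff_exists_nnreal_btwn.1 h
  have hr1' : r < 1 := by exact_mod_cast hr1
  have hg := spectrum.pow_nnnorm_pow_one_div_tendsto_nhds_spectralRadius (A.map Complex.ofReal)
  have hev := hg.eventually_lt_const hr
  have hs : Summable fun k => (r : ℝ) ^ k := summable_geometric_of_lt_one r.2 hr1'
  refine Summable.of_norm_bounded_eventually_nat hs ?_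
  filter_upwards [hev, eventually_gt_atTop 0] with k hk hk0
  rw [norm_norm]
  have hk0' : (k : ℝ) ≠ 0 := by positivity
  have h1 : ((‖(A.map Complex.ofReal) ^ k‖₊ : ENNReal) ^ (1 / k : ℝ)) ^ (k : ℝ) ≤
      (r : ENNReal) ^ (k : ℝ) := ENNReal.rpow_le_rpow hk.le (by positivity)
  rw [← ENNReal.rpow_mul, one_div, inv_mul_cancel₀ hk0', ENNReal.rpow_one,
    ENNReal.rpow_natCast] at h1
  have h2 : ‖(A.map Complex.ofReal) ^ k‖₊ ≤ r ^ k := by exact_mod_cast h1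
  exact_mod_cast h2

theorem norm_entry_le (A : Matrix n n ℂ) (i j : n) : ‖A i j‖ ≤ ‖A‖ := by
  rw [Matrix.linfty_opNorm_def]
  have h1 : ‖A i j‖₊ ≤ ∑ j, ‖A i j‖₊ :=
    Finset.single_le_sum (f := fun j => ‖A i j‖₊) (fun _ _ => zero_le) (Finset.mem_univ j)
  have h2 : ∑ j, ‖A i j‖₊ ≤ Finset.univ.sup fun i => ∑ j, ‖A i j‖₊ :=
    Finset.le_sup (f := fun i => ∑ j, ‖A i j‖₊) (Finset.mem_univ i)
  exact_mod_cast h1.trans h2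

theorem IsSchur.summable_abs {A : Matrix n n ℝ} (h : IsSchur A) (i j : n) :
    Summable fun k => |(A ^ k) i j| := by
  refine Summable.of_nonneg_of_le (fun _ => abs_nonneg _) (fun k => ?_) h.summable_norm_pow
  have := norm_entry_le (A.map Complex.ofReal ^ k) i j
  rw [← map_ofReal_pow] at this ⊢
  simpa using this

theorem IsSchur.tendsto_pow {A : Matrix n n ℝ} (h : IsSchur A) :
    Tendsto (fun k => A ^ k) atTop (𝓝 0) := by
  refine tendsto_pi_nhds.2 fun i => tendsto_pi_nhds.2 fun j => ?_
  exact (tendsto_zero_iff_abs_tendsto_zero _).2 (h.summable_abs i j).tendsto_atTop_zero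

theorem isSchur_of_tendsto_pow {A : Matrix n n ℝ}
    (h : Tendsto (fun k => A ^ k) atTop (𝓝 0)) : IsSchur A := by
  rw [isSchur_iff_eigenvector]
  intro l z hz hl
  have hk : ∀ k : ℕ, (A ^ k).map Complex.ofReal *ᵥ z = l ^ k • z := by
    intro k
    induction k with
    | zero => simp
    | succ k ih =>
      rw [map_ofReal_pow] at ih ⊢
      rw [pow_succ', ← Matrix.mulVec_mulVec, ih, Matrix.mulVec_smul, hz, smul_smul, pow_succ]
  have hc : Continuous fun M : Matrix n n ℝ => M.map Complex.ofReal *ᵥ z := by fun_prop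
  have ht := (hc.tendsto 0).comp h
  simp only [Function.comp_def, hk] at ht
  have h0 : (0 : Matrix n n ℝ).map Complex.ofReal *ᵥ z = 0 := by
    rw [Matrix.map_zero _ Complex.ofReal_zero, Matrix.zero_mulVec]
  rw [h0] at ht
  ext i
  have hi := (tendsto_pi_nhds.1 ht i).norm
  simp only [Pi.smul_apply, Pi.zero_apply, norm_zero, norm_smul, norm_pow] at hi
  have := ge_of_tendsto' hi (b := ‖z i‖) fun k => le_mul_of_one_le_left (norm_nonneg _)
    (one_le_pow₀ hl)
  simpa using this

theorem isSchur_iff_tendsto_pow {A : Matrix n n ℝ} :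
    IsSchur A ↔ Tendsto (fun k => A ^ k) atTop (𝓝 0) :=
  ⟨IsSchur.tendsto_pow, isSchur_of_tendsto_pow⟩

theorem IsSchur.transpose {A : Matrix n n ℝ} (h : IsSchur A) : IsSchur Aᵀ := by
  rw [isSchur_iff_tendsto_pow] at h ⊢
  have := ((continuous_id (X := Matrix n n ℝ)).matrix_transpose.tendsto 0).comp h
  simpa [Function.comp_def, Matrix.transpose_pow] using this

theorem IsSchur.similar {A M N : Matrix n n ℝ} (h : IsSchur A) (hMN : M * N = 1) :
    IsSchur (N * A * M) := by
  rw [isSchur_iff_tendsto_pow] at h ⊢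
  have hk : ∀ k : ℕ, (N * A * M) ^ k = N * A ^ k * M := by
    intro k
    induction k with
    | zero => simpa using (mul_eq_one_comm.1 hMN).symm
    | succ k ih => rw [pow_succ, ih, pow_succ]; simp only [mul_assoc]
                   rw [← mul_assoc M N, hMN, one_mul]
  have hc : Continuous fun B : Matrix n n ℝ => N * B * M := by fun_prop
  have := (hc.tendsto 0).comp h
  simpa [Function.comp_def, hk] using this

theorem IsSchur.fromBlocks_zero₂₁ {A : Matrix n n ℝ} {D : Matrix m m ℝ} (hA : IsSchur A)
    (hD : IsSchur D) (B : Matrix n m ℝ) : IsSchur (fromBlocks A B 0 D) := by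
  rw [isSchur_iff_eigenvector] at *
  intro l z hz hl
  rw [Matrix.fromBlocks_map, Matrix.map_zero _ Complex.ofReal_zero, Matrix.fromBlocks_mulVec] at hz
  have h2 : z ∘ Sum.inr = 0 := by
    refine hD l _ ?_ hl
    ext i
    have := congrFun hz (Sum.inr i)
    simpa using this
  have h1 : z ∘ Sum.inl = 0 := by
    refine hA l _ ?_ hl
    ext i
    have := congrFun hz (Sum.inl i)
    simpa [h2] using this
  ext (i | i)
  · exact congrFun h1 i
  · exact congrFun h2 i

/-- `B` undoes `A` along the orbit of `z`, so `z = B ^ k (A ^ k z)`, and both powers tend to zero.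
This serves to show that the kernels of certain Gramians are trivial. -/
theorem IsSchur.eq_zero_of_fixed {A B : Matrix n n ℝ} (hA : IsSchur A) (hB : IsSchur B)
    (S : Set (n → ℝ)) (hS : ∀ z ∈ S, A *ᵥ z ∈ S) (hBA : ∀ z ∈ S, B *ᵥ (A *ᵥ z) = z)
    {z : n → ℝ} (hz : z ∈ S) : z = 0 := by
  have hk : ∀ k : ℕ, A ^ k *ᵥ z ∈ S ∧ B ^ k *ᵥ (A ^ k *ᵥ z) = z := by
    intro k
    induction k with
    | zero => simpa using hz
    | succ k ih =>
      have e : A ^ (k + 1) *ᵥ z = A *ᵥ (A ^ k *ᵥ z) := by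
        rw [pow_succ', Matrix.mulVec_mulVec]
      refine ⟨e ▸ hS _ ih.1, ?_⟩
      rw [e, pow_succ, ← Matrix.mulVec_mulVec, hBA _ ih.1, ih.2]
  have hc : Continuous fun M : Matrix n n ℝ × Matrix n n ℝ => M.1 *ᵥ (M.2 *ᵥ z) := by fun_prop
  have ht := (hc.tendsto (0, 0)).comp (hB.tendsto_pow.prodMk_nhds hA.tendsto_pow)
  simp only [Function.comp_def, (hk _).2, Matrix.zero_mulVec] at ht
  exact tendsto_nhds_unique tendsto_const_nhds ht

/-- If `‖l‖ > 1`, every root of the characteristic polynomial of `M k` stays at distance at least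
`‖l‖ - 1` from `l`, so `|det (l - M k)|` is bounded below uniformly in `k`, contradicting continuity
of the determinant. -/
theorem norm_le_one_of_eigenvector_of_tendsto {M : ℕ → Matrix n n ℝ} {A : Matrix n n ℝ}
    (hM : ∀ k, IsSchur (M k)) (hlim : Tendsto M atTop (𝓝 A)) {l : ℂ} {z : n → ℂ}
    (hz : A.map Complex.ofReal *ᵥ z = l • z) (hz0 : z ≠ 0) : ‖l‖ ≤ 1 := by
  by_contra! hl
  have hbound : ∀ k, (‖l‖ - 1) ^ Fintype.card n ≤
      ‖(Matrix.scalar n l - (M k).map Complex.ofReal).det‖ := by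
    intro k
    rw [← Matrix.eval_charpoly]
    set P := ((M k).map Complex.ofReal).charpoly with hP
    have hs := IsAlgClosed.splits P
    have hmon : P.Monic := Matrix.charpoly_monic _
    have hev : P.eval l = (P.roots.map fun r => l - r).prod := by
      rw [hs.eval_eq_prod_roots, hmon.leadingCoeff, one_mul]
    have hcard : P.roots.card = Fintype.card n := by
      rw [← hs.natDegree_eq_card_roots, hP, Matrix.charpoly_natDegree_eq_dim]
    have hroots : ∀ r ∈ P.roots, ‖l‖ - 1 ≤ ‖l - r‖ := by
      intro r hr
      have hr' : P.eval r = 0 := (Polynomial.mem_roots'.1 hr).2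
      rw [hP, Matrix.eval_charpoly, ← Matrix.exists_mulVec_eq_zero_iff] at hr'
      obtain ⟨y, hy0, hy⟩ := hr'
      have hr1 : ‖r‖ < 1 := by
        by_contra! hcon
        refine hy0 (isSchur_iff_eigenvector.1 (hM k) r y ?_ hcon)
        rw [Matrix.sub_mulVec, sub_eq_zero] at hy
        rw [← hy, Matrix.scalar_apply, ← Matrix.smul_one_eq_diagonal, Matrix.smul_mulVec,
          Matrix.one_mulVec]
      linarith [norm_sub_norm_le l r]
    rw [hev, ← hcard]
    generalize P.roots = s at hroots
    induction s using Multiset.induction_on with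
    | empty => simp
    | cons a s ih =>
      simp only [Multiset.map_cons, Multiset.prod_cons, Multiset.card_cons, norm_mul, pow_succ']
      exact mul_le_mul (hroots a (Multiset.mem_cons_self a s))
        (ih fun r hr => hroots r (Multiset.mem_cons_of_mem hr))
        (pow_nonneg (by linarith) _) (norm_nonneg _)
  have hc : Continuous fun B : Matrix n n ℝ =>
      ‖(Matrix.scalar n l - B.map Complex.ofReal).det‖ := by fun_prop
  have h1 := ge_of_tendsto' ((hc.tendsto A).comp hlim) hbound
  have h0 : (Matrix.scalar n l - A.map Complex.ofReal).det = 0 := by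
    rw [← Matrix.exists_mulVec_eq_zero_iff]
    refine ⟨z, hz0, ?_⟩
    rw [Matrix.sub_mulVec, hz, Matrix.scalar_apply, ← Matrix.smul_one_eq_diagonal,
      Matrix.smul_mulVec, Matrix.one_mulVec, sub_self]
  rw [h0, norm_zero] at h1
  exact absurd h1 (not_le.2 (pow_pos (by linarith) _))

end Schur

/-! ### Positive semidefinite real matrices -/

section PosSemidef

variable {n m p : Type*} [Fintype n] [Fintype m] [Fintype p]

theorem posSemidef_transpose_mul_self (M : Matrix p n ℝ) : (Mᵀ * M).PosSemidef := by
  simpa [Matrix.conjTranspose_eq_transpose_of_trivial] using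
    Matrix.posSemidef_conjTranspose_mul_self M

theorem _root_.Matrix.PosSemidef.transpose_mul_mul_same {X : Matrix n n ℝ} (hX : X.PosSemidef)
    (M : Matrix n m ℝ) : (Mᵀ * X * M).PosSemidef := by
  simpa [Matrix.conjTranspose_eq_transpose_of_trivial] using hX.conjTranspose_mul_mul_same M

theorem _root_.Matrix.PosSemidef.transpose_eq {k : Type*} {X : Matrix k k ℝ} (hX : X.PosSemidef) :
    Xᵀ = X := by
  simpa [Matrix.conjTranspose_eq_transpose_of_trivial] using hX.isHermitian.eq

theorem _root_.Matrix.PosSemidef.dotProduct_nonneg {X : Matrix n n ℝ} (hX : X.PosSemidef)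
    (z : n → ℝ) : 0 ≤ z ⬝ᵥ X *ᵥ z := by
  simpa using hX.dotProduct_mulVec_nonneg z

theorem _root_.Matrix.PosSemidef.mulVec_eq_zero {X : Matrix n n ℝ} (hX : X.PosSemidef)
    {z : n → ℝ} (hz : z ⬝ᵥ X *ᵥ z = 0) : X *ᵥ z = 0 :=
  (hX.dotProduct_mulVec_zero_iff z).1 (by simpa using hz)

theorem posSemidef_of_symm {X : Matrix n n ℝ} (hs : Xᵀ = X) (h : ∀ z, 0 ≤ z ⬝ᵥ X *ᵥ z) :
    X.PosSemidef :=
  .of_dotProduct_mulVec_nonneg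
    (by rw [Matrix.IsHermitian, Matrix.conjTranspose_eq_transpose_of_trivial, hs])
    (by simpa using h)

theorem _root_.Matrix.PosSemidef.posDef_of_ker {X : Matrix n n ℝ} (hX : X.PosSemidef)
    (h : ∀ z, X *ᵥ z = 0 → z = 0) : X.PosDef :=
  .of_dotProduct_mulVec_pos hX.1 fun z hz =>
    lt_of_le_of_ne (hX.dotProduct_mulVec_nonneg z) fun h0 =>
      hz (h z ((hX.dotProduct_mulVec_zero_iff z).1 h0.symm))

open scoped MatrixOrder in
theorem _root_.Matrix.PosSemidef.exists_factor [DecidableEq n] {X : Matrix n n ℝ}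
    (hX : X.PosSemidef) : ∃ Y : Matrix n n ℝ, X = Yᵀ * Y := by
  obtain ⟨Y, hY⟩ := CStarAlgebra.nonneg_iff_eq_star_mul_self.mp hX.nonneg
  exact ⟨Y, by rw [hY, Matrix.star_eq_conjTranspose,
    Matrix.conjTranspose_eq_transpose_of_trivial]⟩

theorem _root_.Matrix.PosDef.exists_factor [DecidableEq n] {X : Matrix n n ℝ}
    (hX : X.PosDef) : ∃ Y : Matrix n n ℝ, X = Yᵀ * Y ∧ IsUnit Y := by
  obtain ⟨Y, hY⟩ := hX.posSemidef.exists_factor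
  refine ⟨Y, hY, ?_⟩
  have h := hX.isUnit
  rw [hY, Matrix.isUnit_iff_isUnit_det, Matrix.det_mul] at h
  exact (Matrix.isUnit_iff_isUnit_det _).2 (isUnit_of_mul_isUnit_right h)

theorem dotProduct_transpose_mulVec (M : Matrix n m ℝ) (x : m → ℝ) (y : n → ℝ) :
    x ⬝ᵥ Mᵀ *ᵥ y = M *ᵥ x ⬝ᵥ y := by
  rw [Matrix.mulVec_transpose, dotProduct_comm, ← Matrix.dotProduct_mulVec, dotProduct_comm]

theorem dotProduct_transpose_mul_mulVec (M : Matrix p n ℝ) (N : Matrix p m ℝ) (x : n → ℝ)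
    (y : m → ℝ) : x ⬝ᵥ (Mᵀ * N) *ᵥ y = M *ᵥ x ⬝ᵥ N *ᵥ y := by
  rw [← Matrix.mulVec_mulVec, dotProduct_transpose_mulVec]

theorem posSemidef_of_tendsto {X : ℕ → Matrix n n ℝ} {L : Matrix n n ℝ}
    (hX : ∀ k, (X k).PosSemidef) (h : Tendsto X atTop (𝓝 L)) : L.PosSemidef := by
  refine posSemidef_of_symm ?_ fun z => ?_
  · have h1 := ((continuous_id (X := Matrix n n ℝ)).matrix_transpose.tendsto L).comp h
    refine tendsto_nhds_unique h1 ?_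
    simpa [Function.comp_def, fun k => (hX k).transpose_eq] using h
  · have hc : Continuous fun M : Matrix n n ℝ => z ⬝ᵥ M *ᵥ z := by fun_prop
    exact ge_of_tendsto' ((hc.tendsto L).comp h) fun k => (hX k).dotProduct_nonneg z

/-- Each quadratic form is antitone and bounded below by zero, hence converges; polarization
transfers this to the entries. -/
theorem exists_tendsto_of_decreasing [DecidableEq n] {X : ℕ → Matrix n n ℝ}
    (hX : ∀ k, (X k).PosSemidef) (hd : ∀ k, (X k - X (k + 1)).PosSemidef) :
    ∃ L, Tendsto X atTop (𝓝 L) := by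
  have hq : ∀ z : n → ℝ, ∃ a, Tendsto (fun k => z ⬝ᵥ X k *ᵥ z) atTop (𝓝 a) := by
    intro z
    refine ⟨_, tendsto_atTop_ciInf (antitone_nat_of_succ_le fun k => ?_)
      ⟨0, by rintro _ ⟨k, rfl⟩; exact (hX k).dotProduct_nonneg z⟩⟩
    have := (hd k).dotProduct_nonneg z
    rw [Matrix.sub_mulVec, dotProduct_sub] at this
    linarith
  choose q hq using hq
  refine ⟨fun i j => (q (Pi.single i 1 + Pi.single j 1) - q (Pi.single i 1) - q (Pi.single j 1)) / 2,
    tendsto_pi_nhds.2 fun i => tendsto_pi_nhds.2 fun j => ?_⟩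
  have := (((hq (Pi.single i 1 + Pi.single j 1)).sub (hq (Pi.single i 1))).sub
    (hq (Pi.single j 1))).div_const 2
  refine this.congr fun k => ?_
  have hs : X k j i = X k i j := congrFun (congrFun (hX k).transpose_eq i) j
  simp only [Matrix.mulVec_add, dotProduct_add, add_dotProduct, Matrix.mulVec_single_one,
    single_dotProduct, Matrix.col_apply, one_mul, hs]
  ring

theorem star_dotProduct_map_transpose_mul (M N : Matrix p n ℝ) (z : n → ℂ) :
    star z ⬝ᵥ (Mᵀ * N).map Complex.ofReal *ᵥ z =
      star (M.map Complex.ofReal *ᵥ z) ⬝ᵥ N.map Complex.ofReal *ᵥ z := by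
  have h : (Mᵀ * N).map Complex.ofReal = (M.map Complex.ofReal)ᴴ * N.map Complex.ofReal := by
    have h1 : (M.map Complex.ofReal)ᴴ = Mᵀ.map Complex.ofReal := by
      ext i j; simp [Matrix.conjTranspose_apply]
    rw [h1]
    exact Matrix.map_mul (f := Complex.ofRealHom)
  rw [h, ← Matrix.mulVec_mulVec, Matrix.dotProduct_mulVec, Matrix.star_mulVec]

open scoped ComplexOrder in
/-- An eigenvector of `A` outside the open unit disc is annihilated by the cost `N`. -/
theorem mulVec_eq_zero_of_lyapunov {X A : Matrix n n ℝ} {N : Matrix p n ℝ} (hX : X.PosSemidef)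
    (h : X = Aᵀ * X * A + Nᵀ * N) {l : ℂ} {z : n → ℂ}
    (hz : A.map Complex.ofReal *ᵥ z = l • z) (hl : 1 ≤ ‖l‖) : N.map Complex.ofReal *ᵥ z = 0 := by
  classical
  obtain ⟨Y, rfl⟩ := hX.exists_factor
  have hmap : ((Y * A).map Complex.ofReal) *ᵥ z = l • (Y.map Complex.ofReal *ᵥ z) := by
    have : (Y * A).map Complex.ofReal = Y.map Complex.ofReal * A.map Complex.ofReal :=
      Matrix.map_mul (f := Complex.ofRealHom)
    rw [this, ← Matrix.mulVec_mulVec, hz, Matrix.mulVec_smul]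
  have h' : Yᵀ * Y = (Y * A)ᵀ * (Y * A) + Nᵀ * N := by
    rw [Matrix.transpose_mul]; simpa only [Matrix.mul_assoc] using h
  have h1 : star z ⬝ᵥ (Yᵀ * Y).map Complex.ofReal *ᵥ z =
      star z ⬝ᵥ ((Y * A)ᵀ * (Y * A)).map Complex.ofReal *ᵥ z +
        star z ⬝ᵥ (Nᵀ * N).map Complex.ofReal *ᵥ z := by
    conv_lhs => rw [h', Matrix.map_add _ (by simp), Matrix.add_mulVec, dotProduct_add]
  simp only [star_dotProduct_map_transpose_mul, hmap, star_smul, smul_dotProduct,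
    dotProduct_smul, smul_eq_mul] at h1
  have ha : 0 ≤ star (Y.map Complex.ofReal *ᵥ z) ⬝ᵥ (Y.map Complex.ofReal *ᵥ z) :=
    dotProduct_star_self_nonneg _
  have hb : 0 ≤ star (N.map Complex.ofReal *ᵥ z) ⬝ᵥ (N.map Complex.ofReal *ᵥ z) :=
    dotProduct_star_self_nonneg _
  rw [← dotProduct_star_self_eq_zero]
  rw [← mul_assoc, show l * star l = ((‖l‖ ^ 2 : ℝ) : ℂ) by
    exact_mod_cast Complex.mul_conj' l] at h1
  generalize star (Y.map Complex.ofReal *ᵥ z) ⬝ᵥ (Y.map Complex.ofReal *ᵥ z) = a at *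
  generalize star (N.map Complex.ofReal *ᵥ z) ⬝ᵥ (N.map Complex.ofReal *ᵥ z) = b at *
  rw [Complex.nonneg_iff] at ha hb
  -- With `a = ‖Y z‖²` and `b = ‖N z‖²` the equation reads `a = ‖l‖² a + b`, which forces `b = 0`
  -- when `‖l‖ ≥ 1`.
  have hre := congrArg Complex.re h1
  rw [Complex.add_re, Complex.re_ofReal_mul] at hre
  have : 1 ≤ ‖l‖ ^ 2 := one_le_pow₀ hl
  refine Complex.ext ?_ hb.2.symm
  simp only [Complex.zero_re]
  nlinarith [mul_nonneg (sub_nonneg.2 this) ha.1]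

end PosSemidef

/-! ### Lyapunov equations -/

section Lyapunov

variable {n m p : Type*} [Fintype n] [DecidableEq n] [Fintype m] [DecidableEq m] [Fintype p]

theorem eq_zero_of_transpose_mul_mul {A B X : Matrix n n ℝ} (hA : IsSchur A) (hB : IsSchur B)
    (h : X = Aᵀ * X * B) : X = 0 := by
  have hk : ∀ k : ℕ, Aᵀ ^ k * X * B ^ k = X := by
    intro k
    induction k with
    | zero => simp
    | succ k ih =>
      calc Aᵀ ^ (k + 1) * X * B ^ (k + 1) = Aᵀ ^ k * (Aᵀ * X * B) * B ^ k := by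
            rw [pow_succ, pow_succ']; simp only [mul_assoc]
        _ = X := by rw [← h, ih]
  have hc : Continuous fun M : Matrix n n ℝ × Matrix n n ℝ => M.1 * X * M.2 := by fun_prop
  have ht := (hc.tendsto (0, 0)).comp (hA.transpose.tendsto_pow.prodMk_nhds hB.tendsto_pow)
  simp only [Function.comp_def, hk, zero_mul] at ht
  exact tendsto_nhds_unique tendsto_const_nhds ht

/-- The form of `X` does not increase along orbits of `A`, and these tend to zero, so its initial
value is nonnegative. -/
theorem posSemidef_of_sub_posSemidef {A X : Matrix n n ℝ} (hA : IsSchur A)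
    (hs : Xᵀ = X) (h : (X - Aᵀ * X * A).PosSemidef) : X.PosSemidef := by
  refine posSemidef_of_symm hs fun z => ?_
  have hk : ∀ k : ℕ, (A ^ k *ᵥ z) ⬝ᵥ X *ᵥ (A ^ k *ᵥ z) ≤ z ⬝ᵥ X *ᵥ z := by
    intro k
    induction k with
    | zero => simp
    | succ k ih =>
      refine le_trans ?_ ih
      have h1 := h.dotProduct_nonneg (A ^ k *ᵥ z)
      rw [Matrix.sub_mulVec, dotProduct_sub, Matrix.mul_assoc, dotProduct_transpose_mul_mulVec,
        ← Matrix.mulVec_mulVec] at h1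
      rw [pow_succ', ← Matrix.mulVec_mulVec]
      linarith
  have hc : Continuous fun M : Matrix n n ℝ => (M *ᵥ z) ⬝ᵥ X *ᵥ (M *ᵥ z) := by fun_prop
  have ht := (hc.tendsto 0).comp hA.tendsto_pow
  rw [Matrix.zero_mulVec, zero_dotProduct] at ht
  exact le_of_tendsto' ht hk

/-- The Lyapunov operator is injective on a finite-dimensional space, hence surjective; injectivity
also makes the solution symmetric. -/
theorem exists_lyapunov {A Q : Matrix n n ℝ} (hA : IsSchur A) (hQ : Q.PosSemidef) :
    ∃ X : Matrix n n ℝ, X.PosSemidef ∧ X = Aᵀ * X * A + Q := by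
  let f : Matrix n n ℝ →ₗ[ℝ] Matrix n n ℝ :=
    LinearMap.id - (LinearMap.mulRight ℝ A).comp (LinearMap.mulLeft ℝ Aᵀ)
  have hf : ∀ X, f X = X - Aᵀ * X * A := fun X => rfl
  have hinj : Function.Injective f := by
    rw [injective_iff_map_eq_zero]
    intro X hX
    exact eq_zero_of_transpose_mul_mul hA hA (sub_eq_zero.1 hX)
  obtain ⟨X, hX⟩ := LinearMap.injective_iff_surjective.1 hinj Q
  have hsymm : Xᵀ = X := by
    refine hinj ?_
    rw [hX, hf, ← hQ.transpose_eq, ← hX, hf]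
    simp only [Matrix.transpose_sub, Matrix.transpose_mul, Matrix.transpose_transpose,
      Matrix.mul_assoc]
  rw [hf] at hX
  exact ⟨X, posSemidef_of_sub_posSemidef hA hsymm (hX ▸ hQ), by rw [← hX]; abel⟩

end Lyapunov

/-! ### Riccati equations -/

section Riccati

variable {n m p : Type*} [Fintype n] [DecidableEq n] [Fintype m] [DecidableEq m] [Fintype p]

section Gain

variable {A : Matrix n n ℝ} {B : Matrix n m ℝ} {R : Matrix m m ℝ} {S : Matrix n m ℝ}
  {X : Matrix n n ℝ}

omit [DecidableEq n] in
theorem mul_dareGain (hH : IsUnit (R + Bᵀ * X * B)) :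
    (R + Bᵀ * X * B) * dareGain A B R S X = (Aᵀ * X * B + S)ᵀ := by
  rw [dareGain, ← Matrix.mul_assoc,
    Matrix.mul_nonsing_inv _ ((Matrix.isUnit_iff_isUnit_det _).1 hH), Matrix.one_mul]

omit [Fintype m] [DecidableEq n] [DecidableEq m] in
theorem transpose_innovation (hX : Xᵀ = X) (hR : Rᵀ = R) :
    (R + Bᵀ * X * B)ᵀ = R + Bᵀ * X * B := by
  simp only [Matrix.transpose_add, Matrix.transpose_mul, Matrix.transpose_transpose, hX, hR,
    Matrix.mul_assoc]

omit [DecidableEq n] in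
theorem dareGain_transpose_mul (hX : Xᵀ = X) (hR : Rᵀ = R) (hH : IsUnit (R + Bᵀ * X * B)) :
    (dareGain A B R S X)ᵀ * (R + Bᵀ * X * B) = Aᵀ * X * B + S := by
  have := congrArg Matrix.transpose (mul_dareGain (A := A) (S := S) hH)
  rwa [Matrix.transpose_mul, Matrix.transpose_transpose, transpose_innovation hX hR] at this

omit [DecidableEq n] in
theorem dare_correction (hX : Xᵀ = X) (hR : Rᵀ = R) (hH : IsUnit (R + Bᵀ * X * B)) :
    (Aᵀ * X * B + S) * (R + Bᵀ * X * B)⁻¹ * (Aᵀ * X * B + S)ᵀ =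
      (dareGain A B R S X)ᵀ * (R + Bᵀ * X * B) * dareGain A B R S X := by
  rw [dareGain_transpose_mul hX hR hH, dareGain, Matrix.mul_assoc]

omit [DecidableEq n] [DecidableEq m] in
theorem posDef_innovation (hR : R.PosDef) (hX : X.PosSemidef) :
    (R + Bᵀ * X * B).PosDef :=
  hR.add_posSemidef (hX.transpose_mul_mul_same B)

end Gain

/-- Two stabilizing solutions of a DARE coincide. -/
theorem IsStabilizingSolution.unique {A : Matrix n n ℝ} {B : Matrix n m ℝ} {Q : Matrix n n ℝ}
    {R : Matrix m m ℝ} {S : Matrix n m ℝ} {X Y : Matrix n n ℝ} (hR : R.PosDef)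
    (hX : IsStabilizingSolution A B Q R S X) (hY : IsStabilizingSolution A B Q R S Y) : X = Y := by
  have hRs := hR.posSemidef.transpose_eq
  have hUX := (posDef_innovation (B := B) hR hX.posSemidef).isUnit
  have hUY := (posDef_innovation (B := B) hR hY.posSemidef).isUnit
  have hXs := hX.posSemidef.transpose_eq
  have hYs := hY.posSemidef.transpose_eq
  have eX := hX.dare
  have eY := hY.dare
  have gX := dareGain_transpose_mul (A := A) (S := S) hXs hRs hUX
  have gY := mul_dareGain (A := A) (S := S) hUY
  rw [dare_correction hXs hRs hUX, Matrix.mul_assoc (dareGain A B R S X)ᵀ, mul_dareGain hUX] at eX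
  rw [dare_correction hYs hRs hUY, dareGain_transpose_mul hYs hRs hUY] at eY
  -- The target is the mixed equation `X - Y = (A - B K)ᵀ (X - Y) (A - B L)`. Each DARE is used with
  -- only one of its two factors closed by feedback, which lets the weights `Q`, `R`, `S` cancel.
  refine sub_eq_zero.1 (eq_zero_of_transpose_mul_mul hX.schur hY.schur ?_)
  generalize dareGain A B R S X = K at *
  generalize dareGain A B R S Y = L at *
  have h1 : (A - B * K)ᵀ * X * A = X - Q + Kᵀ * Sᵀ := by
    rw [← sub_eq_zero, ← neg_eq_zero, eX]
    simp only [Matrix.transpose_sub, Matrix.transpose_add, Matrix.transpose_mul,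
      Matrix.transpose_transpose, hXs, Matrix.sub_mul, Matrix.mul_add, Matrix.mul_assoc]
    abel
  have h2 : (A - B * K)ᵀ * X * B = Kᵀ * R - S := by
    rw [eq_sub_iff_add_eq, ← sub_eq_zero]
    rw [Matrix.mul_add, ← sub_eq_zero] at gX
    rw [← neg_eq_zero, ← gX]
    simp only [Matrix.transpose_sub, Matrix.transpose_mul, Matrix.sub_mul, Matrix.mul_assoc]
    abel
  have h3 : Aᵀ * Y * (A - B * L) = Y - Q + S * L := by
    rw [← sub_eq_zero, ← neg_eq_zero, eY]
    simp only [Matrix.mul_sub, Matrix.add_mul, Matrix.mul_assoc]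
    abel
  have h4 : Bᵀ * Y * (A - B * L) = R * L - Sᵀ := by
    rw [eq_sub_iff_add_eq, ← sub_eq_zero]
    rw [Matrix.add_mul, ← sub_eq_zero] at gY
    rw [← neg_eq_zero, ← gY]
    simp only [Matrix.transpose_add, Matrix.transpose_mul, Matrix.transpose_transpose, hYs,
      Matrix.mul_sub, Matrix.mul_assoc]
    abel
  have h5 : (A - B * K)ᵀ * (X - Y) * (A - B * L) =
      (A - B * K)ᵀ * X * A - (A - B * K)ᵀ * X * B * L -
        (Aᵀ * Y * (A - B * L) - Kᵀ * (Bᵀ * Y * (A - B * L))) := by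
    simp only [Matrix.transpose_sub, Matrix.transpose_mul, Matrix.sub_mul, Matrix.mul_sub,
      Matrix.mul_assoc]
    abel
  rw [h5, h1, h2, h3, h4]
  simp only [Matrix.sub_mul, Matrix.mul_sub, Matrix.mul_assoc]
  abel

omit [DecidableEq n] in
/-- The closed-loop cost of an arbitrary feedback `K`, by completion of squares. -/
theorem closedLoop_cost {A : Matrix n n ℝ} {B : Matrix n m ℝ} {C : Matrix p n ℝ}
    {D : Matrix p m ℝ} {X : Matrix n n ℝ} (hX : Xᵀ = X) (hH : IsUnit (Dᵀ * D + Bᵀ * X * B))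
    (K : Matrix m n ℝ) :
    (A - B * K)ᵀ * X * (A - B * K) + (C - D * K)ᵀ * (C - D * K) =
      Aᵀ * X * A + Cᵀ * C -
        (dareGain A B (Dᵀ * D) (Cᵀ * D) X)ᵀ * (Dᵀ * D + Bᵀ * X * B) *
          dareGain A B (Dᵀ * D) (Cᵀ * D) X +
        (K - dareGain A B (Dᵀ * D) (Cᵀ * D) X)ᵀ * (Dᵀ * D + Bᵀ * X * B) *
          (K - dareGain A B (Dᵀ * D) (Cᵀ * D) X) := by
  have hRs : (Dᵀ * D)ᵀ = Dᵀ * D := by simp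
  have h1 := mul_dareGain (A := A) (S := Cᵀ * D) hH
  have h2 := dareGain_transpose_mul (A := A) (S := Cᵀ * D) hX hRs hH
  generalize dareGain A B (Dᵀ * D) (Cᵀ * D) X = G at *
  have h3 : (K - G)ᵀ * (Dᵀ * D + Bᵀ * X * B) * (K - G) =
      Kᵀ * (Dᵀ * D + Bᵀ * X * B) * K - (Aᵀ * X * B + Cᵀ * D) * K - Kᵀ * (Aᵀ * X * B + Cᵀ * D)ᵀ
        + Gᵀ * (Dᵀ * D + Bᵀ * X * B) * G := by
    rw [← h1, ← h2]
    simp only [Matrix.transpose_sub, Matrix.sub_mul, Matrix.mul_sub, Matrix.mul_assoc]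
    abel
  rw [h3]
  simp only [Matrix.transpose_sub, Matrix.transpose_add, Matrix.transpose_mul,
    Matrix.transpose_transpose, hX, Matrix.sub_mul, Matrix.mul_sub, Matrix.add_mul,
    Matrix.mul_add, Matrix.mul_assoc]
  abel

omit [DecidableEq n] in
-- At the optimal gain the square in `closedLoop_cost` vanishes, so the DARE is the Lyapunov
-- equation of its own closed loop.
theorem dare_iff_closedLoop {A : Matrix n n ℝ} {B : Matrix n m ℝ} {C : Matrix p n ℝ}
    {D : Matrix p m ℝ} {X : Matrix n n ℝ} (hX : Xᵀ = X) (hH : IsUnit (Dᵀ * D + Bᵀ * X * B)) :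
    0 = X - Aᵀ * X * A - Cᵀ * C + (Aᵀ * X * B + Cᵀ * D) * (Dᵀ * D + Bᵀ * X * B)⁻¹ *
        (Aᵀ * X * B + Cᵀ * D)ᵀ ↔
      X = (A - B * dareGain A B (Dᵀ * D) (Cᵀ * D) X)ᵀ * X *
          (A - B * dareGain A B (Dᵀ * D) (Cᵀ * D) X) +
        (C - D * dareGain A B (Dᵀ * D) (Cᵀ * D) X)ᵀ *
          (C - D * dareGain A B (Dᵀ * D) (Cᵀ * D) X) := by
  rw [closedLoop_cost hX hH, dare_correction hX (by simp) hH, sub_self, Matrix.transpose_zero,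
    Matrix.zero_mul, Matrix.zero_mul, add_zero, eq_comm, ← sub_eq_zero (a := X)]
  refine Eq.congr ?_ rfl
  abel

theorem IsStabilizingSolution.closedLoop {A : Matrix n n ℝ} {B : Matrix n m ℝ} {C : Matrix p n ℝ}
    {D : Matrix p m ℝ} {X : Matrix n n ℝ} (hR : (Dᵀ * D).PosDef)
    (h : IsStabilizingSolution A B (Cᵀ * C) (Dᵀ * D) (Cᵀ * D) X) :
    X = (A - B * dareGain A B (Dᵀ * D) (Cᵀ * D) X)ᵀ * X *
          (A - B * dareGain A B (Dᵀ * D) (Cᵀ * D) X) +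
        (C - D * dareGain A B (Dᵀ * D) (Cᵀ * D) X)ᵀ *
          (C - D * dareGain A B (Dᵀ * D) (Cᵀ * D) X) :=
  (dare_iff_closedLoop h.posSemidef.transpose_eq
    (posDef_innovation hR h.posSemidef).isUnit).1 h.dare

omit [DecidableEq n] [DecidableEq m] in
theorem map_sub_mul_mulVec {k q : Type*} [Fintype k] (M : Matrix q n ℝ) (N : Matrix q k ℝ)
    (G : Matrix k n ℝ) (z : n → ℂ) : (M - N * G).map Complex.ofReal *ᵥ z =
      M.map Complex.ofReal *ᵥ z + N.map Complex.ofReal *ᵥ (-(G.map Complex.ofReal *ᵥ z)) := by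
  have : (M - N * G).map Complex.ofReal =
      M.map Complex.ofReal - N.map Complex.ofReal * G.map Complex.ofReal := by
    rw [Matrix.map_sub _ (by simp)]
    congr 1
    exact Matrix.map_mul (f := Complex.ofRealHom)
  rw [this, Matrix.sub_mulVec, ← Matrix.mulVec_mulVec, Matrix.mulVec_neg, sub_eq_add_neg]

omit [DecidableEq n] in
theorem continuousAt_dareGain {A : Matrix n n ℝ} {B : Matrix n m ℝ} {R : Matrix m m ℝ}
    {S : Matrix n m ℝ} {X : Matrix n n ℝ} (hH : IsUnit (R + Bᵀ * X * B)) :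
    ContinuousAt (dareGain A B R S) X := by
  have hdet : (R + Bᵀ * X * B).det ≠ 0 := ((Matrix.isUnit_iff_isUnit_det _).1 hH).ne_zero
  have h1 : ContinuousAt (fun Z : Matrix m m ℝ => Z⁻¹) (R + Bᵀ * X * B) := by
    refine continuousAt_matrix_inv _ ?_
    rw [Ring.inverse_eq_inv']
    exact continuousAt_inv₀ hdet
  have hc : Continuous fun Z : Matrix n n ℝ => R + Bᵀ * Z * B := by fun_prop
  have h2 : ContinuousAt (fun Z : Matrix n n ℝ => (R + Bᵀ * Z * B)⁻¹) X :=
    ContinuousAt.comp (f := fun Z : Matrix n n ℝ => R + Bᵀ * Z * B)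
      (g := fun Z : Matrix m m ℝ => Z⁻¹) h1 hc.continuousAt
  have h3 : Continuous fun Z : Matrix n n ℝ => (Aᵀ * Z * B + S)ᵀ := by fun_prop
  have h4 : Continuous fun Z : Matrix m m ℝ × Matrix m n ℝ => Z.1 * Z.2 := by fun_prop
  exact h4.continuousAt.comp (h2.prodMk h3.continuousAt)

section Orthogonal

variable {A : Matrix n n ℝ} {B : Matrix n m ℝ} {C : Matrix p n ℝ} {D : Matrix p m ℝ}
  {X : Matrix n n ℝ}

/-- This is the normal equation of the optimal gain: the closed-loop columns are orthogonal to `[B;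
D]` in the weight `diag(X, I)`. -/
theorem IsStabilizingSolution.orthogonal (hR : (Dᵀ * D).PosDef)
    (h : IsStabilizingSolution A B (Cᵀ * C) (Dᵀ * D) (Cᵀ * D) X) :
    (A - B * dareGain A B (Dᵀ * D) (Cᵀ * D) X)ᵀ * X * B +
      (C - D * dareGain A B (Dᵀ * D) (Cᵀ * D) X)ᵀ * D = 0 := by
  have h := dareGain_transpose_mul (A := A) (S := Cᵀ * D) h.posSemidef.transpose_eq
    hR.posSemidef.transpose_eq (posDef_innovation (B := B) hR h.posSemidef).isUnit
  rw [← sub_eq_zero, ← neg_eq_zero] at h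
  rw [← h]
  simp only [Matrix.transpose_sub, Matrix.transpose_mul, Matrix.sub_mul, Matrix.mul_add,
    Matrix.mul_assoc]
  abel

omit [DecidableEq n] [DecidableEq m] in
theorem mulVec_add_feedback {k : Type*} (M : Matrix k n ℝ) (N : Matrix k m ℝ) (G : Matrix m n ℝ)
    (x : n → ℝ) (d : m → ℝ) :
    M *ᵥ x + N *ᵥ d = (M - N * G) *ᵥ x + N *ᵥ (d + G *ᵥ x) := by
  rw [Matrix.sub_mulVec, Matrix.mulVec_add, ← Matrix.mulVec_mulVec]
  abel

omit [DecidableEq n] [DecidableEq m] in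
/-- Orthogonality of the columns of `[A B; C D]` in the weight `diag(X, I)` as an energy balance. -/
theorem energy_balance {H : Matrix m m ℝ} (hX : Xᵀ = X) (h11 : Aᵀ * X * A + Cᵀ * C = X)
    (h12 : Aᵀ * X * B + Cᵀ * D = 0) (h22 : Bᵀ * X * B + Dᵀ * D = H) (x : n → ℝ) (d : m → ℝ) :
    (C *ᵥ x + D *ᵥ d) ⬝ᵥ (C *ᵥ x + D *ᵥ d) + (A *ᵥ x + B *ᵥ d) ⬝ᵥ X *ᵥ (A *ᵥ x + B *ᵥ d) =
      d ⬝ᵥ H *ᵥ d + x ⬝ᵥ X *ᵥ x := by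
  have h21 : Bᵀ * X * A + Dᵀ * C = 0 := by
    have := congrArg Matrix.transpose h12
    simpa only [Matrix.transpose_add, Matrix.transpose_mul, Matrix.transpose_transpose, hX,
      Matrix.transpose_zero, Matrix.mul_assoc] using this
  have e11 := congrArg (fun M => x ⬝ᵥ M *ᵥ x) h11
  have e12 := congrArg (fun M => x ⬝ᵥ M *ᵥ d) h12
  have e21 := congrArg (fun M => d ⬝ᵥ M *ᵥ x) h21
  have e22 := congrArg (fun M => d ⬝ᵥ M *ᵥ d) h22
  simp only [Matrix.mul_assoc, Matrix.add_mulVec, dotProduct_add, dotProduct_transpose_mulVec,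
    Matrix.zero_mulVec, dotProduct_zero, ← Matrix.mulVec_mulVec] at e11 e12 e21 e22
  simp only [Matrix.mulVec_add, dotProduct_add, add_dotProduct]
  linarith

theorem IsStabilizingSolution.energy_balance (hR : (Dᵀ * D).PosDef)
    (h : IsStabilizingSolution A B (Cᵀ * C) (Dᵀ * D) (Cᵀ * D) X) (x : n → ℝ) (d : m → ℝ) :
    (C *ᵥ x + D *ᵥ d) ⬝ᵥ (C *ᵥ x + D *ᵥ d) + (A *ᵥ x + B *ᵥ d) ⬝ᵥ X *ᵥ (A *ᵥ x + B *ᵥ d) =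
      (d + dareGain A B (Dᵀ * D) (Cᵀ * D) X *ᵥ x) ⬝ᵥ
        (Dᵀ * D + Bᵀ * X * B) *ᵥ (d + dareGain A B (Dᵀ * D) (Cᵀ * D) X *ᵥ x) + x ⬝ᵥ X *ᵥ x := by
  rw [← RegretControl.energy_balance h.posSemidef.transpose_eq (h.closedLoop hR).symm
    (h.orthogonal hR) (add_comm _ _), ← mulVec_add_feedback, ← mulVec_add_feedback]

end Orthogonal

/-- One step of the policy iteration: improving a stabilizing feedback keeps it stabilizing. -/
theorem isSchur_improved {A : Matrix n n ℝ} {B : Matrix n m ℝ} {C : Matrix p n ℝ}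
    {D : Matrix p m ℝ} {X : Matrix n n ℝ} {K : Matrix m n ℝ} (hR : (Dᵀ * D).PosDef)
    (hK : IsSchur (A - B * K)) (hX : X.PosSemidef)
    (hL : X = (A - B * K)ᵀ * X * (A - B * K) + (C - D * K)ᵀ * (C - D * K)) :
    IsSchur (A - B * dareGain A B (Dᵀ * D) (Cᵀ * D) X) := by
  have hHd := posDef_innovation (B := B) hR hX
  obtain ⟨h, hh, hhu⟩ := hHd.exists_factor
  set G := dareGain A B (Dᵀ * D) (Cᵀ * D) X with hG
  have e1 := closedLoop_cost (A := A) (C := C) hX.transpose_eq hHd.isUnit K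
  have e2 := closedLoop_cost (A := A) (C := C) hX.transpose_eq hHd.isUnit G
  rw [← hG, sub_self, Matrix.transpose_zero, Matrix.zero_mul, Matrix.zero_mul, add_zero] at e2
  rw [← hL, ← hG, ← e2, hh] at e1
  -- The old cost matrix solves the Lyapunov equation of the improved loop with the extra cost `h (K
  -- - G)`. An eigenvector of the improved loop outside the disc is therefore killed by `K - G`, so
  -- it is also an eigenvector of the old, Schur loop.
  have e3 : X = (A - B * G)ᵀ * X * (A - B * G) +
      (fromRows (C - D * G) (h * (K - G)))ᵀ * fromRows (C - D * G) (h * (K - G)) := by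
    rw [Matrix.transpose_fromRows, Matrix.fromCols_mul_fromRows, ← add_assoc]
    conv_lhs => rw [e1]
    rw [Matrix.transpose_mul]
    simp only [Matrix.mul_assoc]
  rw [isSchur_iff_eigenvector] at hK ⊢
  intro l z hz hl
  have hN := mulVec_eq_zero_of_lyapunov hX e3 hz hl
  rw [Matrix.fromRows_map, Matrix.fromRows_mulVec] at hN
  have h2 : (h * (K - G)).map Complex.ofReal *ᵥ z = 0 := by
    ext i; exact congrFun hN (Sum.inr i)
  have h3 : (K - G).map Complex.ofReal *ᵥ z = 0 := by
    have hm : (h⁻¹).map Complex.ofReal * (h * (K - G)).map Complex.ofReal =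
        (K - G).map Complex.ofReal := by
      have := Matrix.map_mul (f := Complex.ofRealHom) (L := h⁻¹) (M := h * (K - G))
      rw [← Matrix.mul_assoc, Matrix.nonsing_inv_mul _ ((Matrix.isUnit_iff_isUnit_det _).1 hhu),
        Matrix.one_mul] at this
      exact this.symm
    rw [← hm, ← Matrix.mulVec_mulVec, h2, Matrix.mulVec_zero]
  refine hK l z ?_ hl
  have hdec : A - B * K = (A - B * G) - B * (K - G) := by
    rw [Matrix.mul_sub]; abel
  rw [hdec, map_sub_mul_mulVec, hz, h3, neg_zero, Matrix.mulVec_zero, add_zero]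

/-- A DARE with positive definite input weight has a stabilizing solution as soon as the pair is
stabilizable and the system has no invariant zero on the unit circle. -/
theorem exists_isStabilizingSolution {A : Matrix n n ℝ} {B : Matrix n m ℝ} {C : Matrix p n ℝ}
    {D : Matrix p m ℝ} (hR : (Dᵀ * D).PosDef) (hs : Stabilizable A B)
    (hz : ∀ (l : ℂ) (z : n → ℂ) (w : m → ℂ), ‖l‖ = 1 →
      A.map Complex.ofReal *ᵥ z + B.map Complex.ofReal *ᵥ w = l • z →
      C.map Complex.ofReal *ᵥ z + D.map Complex.ofReal *ᵥ w = 0 → z = 0) :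
    ∃ X, IsStabilizingSolution A B (Cᵀ * C) (Dᵀ * D) (Cᵀ * D) X := by
  have hex : ∀ K : {K : Matrix m n ℝ // IsSchur (A - B * K)}, ∃ X : Matrix n n ℝ, X.PosSemidef ∧
      X = (A - B * K.1)ᵀ * X * (A - B * K.1) + (C - D * K.1)ᵀ * (C - D * K.1) := fun K =>
    exists_lyapunov K.2 (posSemidef_transpose_mul_self _)
  choose L hLp hL using hex
  let next : {K : Matrix m n ℝ // IsSchur (A - B * K)} → {K : Matrix m n ℝ // IsSchur (A - B * K)} :=
    fun K => ⟨dareGain A B (Dᵀ * D) (Cᵀ * D) (L K), isSchur_improved hR K.2 (hLp K) (hL K)⟩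
  obtain ⟨K₀, hK₀⟩ := hs
  let K : ℕ → {K : Matrix m n ℝ // IsSchur (A - B * K)} := fun k => next^[k] ⟨K₀, hK₀⟩
  have hKs : ∀ k, (K (k + 1)).1 = dareGain A B (Dᵀ * D) (Cᵀ * D) (L (K k)) := by
    intro k
    change (next^[k + 1] ⟨K₀, hK₀⟩).1 = _
    rw [Function.iterate_succ_apply']
  have hdec : ∀ k, (L (K k) - L (K (k + 1))).PosSemidef := by
    intro k
    have hHd := posDef_innovation (B := B) hR (hLp (K k))
    have e1 := closedLoop_cost (A := A) (C := C) (hLp (K k)).transpose_eq hHd.isUnit (K k).1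
    have e2 := closedLoop_cost (A := A) (C := C) (hLp (K k)).transpose_eq hHd.isUnit (K (k + 1)).1
    rw [← hKs, sub_self, Matrix.transpose_zero, Matrix.zero_mul, Matrix.zero_mul, add_zero] at e2
    rw [← hL, ← hKs, ← e2] at e1
    -- The cost decrease solves the Lyapunov equation of the new loop, with the positive
    -- semidefinite source from completing the square at the old gain.
    refine posSemidef_of_sub_posSemidef (K (k + 1)).2 ?_ ?_
    · rw [Matrix.transpose_sub, (hLp _).transpose_eq, (hLp _).transpose_eq]
    · convert hHd.posSemidef.transpose_mul_mul_same ((K k).1 - (K (k + 1)).1) using 1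
      have e3 := hL (K (k + 1))
      generalize (K k).1 = K₁ at *
      generalize (K (k + 1)).1 = K₂ at *
      generalize L (K (k + 1)) = P' at *
      generalize L (K k) = P at *
      generalize A - B * K₂ = A' at *
      rw [Matrix.mul_sub, Matrix.sub_mul]
      generalize (K₁ - K₂)ᵀ * (Dᵀ * D + Bᵀ * P * B) * (K₁ - K₂) = d at *
      generalize A'ᵀ * P * A' = U at *
      generalize A'ᵀ * P' * A' = U' at *
      rw [e1, e3]
      abel
  obtain ⟨X, hX⟩ := exists_tendsto_of_decreasing (fun k => hLp (K k)) hdec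
  have hXp : X.PosSemidef := posSemidef_of_tendsto (fun k => hLp (K k)) hX
  have hHd := posDef_innovation (B := B) hR hXp
  have hKlim : Tendsto (fun k => (K (k + 1)).1) atTop
      (𝓝 (dareGain A B (Dᵀ * D) (Cᵀ * D) X)) := by
    simp only [hKs]
    exact (continuousAt_dareGain hHd.isUnit).tendsto.comp hX
  set G := dareGain A B (Dᵀ * D) (Cᵀ * D) X with hG
  have hlyap : X = (A - B * G)ᵀ * X * (A - B * G) + (C - D * G)ᵀ * (C - D * G) := by
    have hX1 := (tendsto_add_atTop_iff_nat 1).2 hX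
    have hc : Continuous fun Z : Matrix m n ℝ × Matrix n n ℝ =>
        (A - B * Z.1)ᵀ * Z.2 * (A - B * Z.1) + (C - D * Z.1)ᵀ * (C - D * Z.1) := by fun_prop
    have h1 := (hc.tendsto (G, X)).comp (hKlim.prodMk_nhds hX1)
    refine tendsto_nhds_unique hX1 (h1.congr fun k => ?_)
    exact (hL (K (k + 1))).symm
  refine ⟨X, hXp, (dare_iff_closedLoop hXp.transpose_eq hHd.isUnit).2 hlyap, ?_⟩
  rw [← hG, isSchur_iff_eigenvector]
  intro l z hl hl1
  by_contra hz0
  have hAlim : Tendsto (fun k => A - B * (K (k + 1)).1) atTop (𝓝 (A - B * G)) := by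
    have hc : Continuous fun Z : Matrix m n ℝ => A - B * Z := by fun_prop
    exact (hc.tendsto G).comp hKlim
  -- A limit of Schur matrices only has its spectrum in the closed disc. A remaining eigenvector
  -- lies on the circle and has zero output, so it would be an invariant zero.
  have hl2 := norm_le_one_of_eigenvector_of_tendsto (fun k => (K (k + 1)).2) hAlim hl hz0
  have hC := mulVec_eq_zero_of_lyapunov hXp hlyap hl hl1
  exact hz0 (hz l z (-(G.map Complex.ofReal *ᵥ z)) (le_antisymm hl2 hl1)
    (by rw [← map_sub_mul_mulVec]; exact hl) (by rw [← map_sub_mul_mulVec]; exact hC))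

end Riccati

/-! ### Inverses and the dual Gram inequality -/

section Inverse

variable {n m p : Type*} [Fintype n] [DecidableEq n] [Fintype m] [Fintype p]

theorem isUnit_of_mulVec_eq_zero {M : Matrix n n ℝ} (h : ∀ z, M *ᵥ z = 0 → z = 0) : IsUnit M := by
  rw [← Matrix.mulVec_injective_iff_isUnit]
  intro x y hxy
  exact sub_eq_zero.1 (h _ (by rw [Matrix.mulVec_sub]; exact sub_eq_zero.2 hxy))

theorem mul_inv_of_isUnit {M : Matrix n n ℝ} (h : IsUnit M) : M * M⁻¹ = 1 :=
  Matrix.mul_nonsing_inv _ ((Matrix.isUnit_iff_isUnit_det _).1 h)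

theorem inv_mul_of_isUnit {M : Matrix n n ℝ} (h : IsUnit M) : M⁻¹ * M = 1 :=
  Matrix.nonsing_inv_mul _ ((Matrix.isUnit_iff_isUnit_det _).1 h)

/-- If the columns of `[A B; C D]` are orthogonal with Gram matrix `diag(X, H)` in the weight
`diag(X, I)`, then the corresponding row Gram matrix is at most `X⁻¹`. -/
theorem posSemidef_inv_sub {m : Type*} [Fintype m] [DecidableEq m] {A : Matrix n n ℝ}
    {B : Matrix n m ℝ} {C : Matrix p n ℝ} {D : Matrix p m ℝ} {X : Matrix n n ℝ}
    {H : Matrix m m ℝ} (hX : X.PosDef) (hH : H.PosDef) (h11 : Aᵀ * X * A + Cᵀ * C = X)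
    (h12 : Aᵀ * X * B + Cᵀ * D = 0) (h22 : Bᵀ * X * B + Dᵀ * D = H) :
    (X⁻¹ - A * X⁻¹ * Aᵀ - B * H⁻¹ * Bᵀ).PosSemidef := by
  have hXs := hX.posSemidef.transpose_eq
  have hHs := hH.posSemidef.transpose_eq
  have hXi : X⁻¹ᵀ = X⁻¹ := hX.inv.posSemidef.transpose_eq
  have hHi : H⁻¹ᵀ = H⁻¹ := hH.inv.posSemidef.transpose_eq
  have hXX := mul_inv_of_isUnit hX.isUnit
  have hXX' := inv_mul_of_isUnit hX.isUnit
  have h21 : Bᵀ * X * A + Dᵀ * C = 0 := by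
    have := congrArg Matrix.transpose h12
    simpa only [Matrix.transpose_add, Matrix.transpose_mul, Matrix.transpose_transpose, hXs,
      Matrix.transpose_zero, Matrix.mul_assoc] using this
  obtain ⟨J, hJ⟩ : ∃ J, J = X⁻¹ * Aᵀ := ⟨_, rfl⟩
  obtain ⟨L, hL⟩ : ∃ L, L = H⁻¹ * Bᵀ := ⟨_, rfl⟩
  have hJX : Jᵀ * X * J = A * J := by
    rw [hJ, Matrix.transpose_mul, hXi, Matrix.transpose_transpose]
    simp only [Matrix.mul_assoc]
    rw [← Matrix.mul_assoc X, hXX, Matrix.one_mul]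
  have hLH : Lᵀ * H * L = B * L := by
    rw [hL, Matrix.transpose_mul, hHi, Matrix.transpose_transpose]
    simp only [Matrix.mul_assoc]
    rw [← Matrix.mul_assoc H, mul_inv_of_isUnit hH.isUnit, Matrix.one_mul]
  have hsym : (A * J + B * L)ᵀ = A * J + B * L := by
    rw [← hJX, ← hLH]
    simp only [Matrix.transpose_add, Matrix.transpose_mul, Matrix.transpose_transpose, hXs, hHs,
      Matrix.mul_assoc]
  have hkey : (A * J + B * L)ᵀ * X * (A * J + B * L) + (C * J + D * L)ᵀ * (C * J + D * L) =
      A * J + B * L := by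
    calc _ = Jᵀ * (Aᵀ * X * A + Cᵀ * C) * J + Jᵀ * (Aᵀ * X * B + Cᵀ * D) * L +
          Lᵀ * (Bᵀ * X * A + Dᵀ * C) * J + Lᵀ * (Bᵀ * X * B + Dᵀ * D) * L := by
          simp only [Matrix.transpose_add, Matrix.transpose_mul, Matrix.add_mul, Matrix.mul_add,
            Matrix.mul_assoc]
          abel
      _ = A * J + B * L := by
          rw [h11, h12, h21, h22, hJX, hLH]; simp
  have e : X⁻¹ - A * X⁻¹ * Aᵀ - B * H⁻¹ * Bᵀ = X⁻¹ - (A * J + B * L) := by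
    rw [hJ, hL]; simp only [Matrix.mul_assoc]; abel
  rw [e]
  generalize A * J + B * L = Φ at *
  -- Here `Φ` is the row Gram matrix. The column relations give `Φ X Φ + Nᵀ N = Φ` with `N = C J + D
  -- L`, and expanding `(X⁻¹ - Φ) X (X⁻¹ - Φ)` leaves exactly `Nᵀ N` to be added.
  have e2 : X⁻¹ - Φ = (X⁻¹ - Φ)ᵀ * X * (X⁻¹ - Φ) + (C * J + D * L)ᵀ * (C * J + D * L) := by
    rw [hsym] at hkey
    have e3 : (X⁻¹ - Φ) * X * (X⁻¹ - Φ) = X⁻¹ - Φ - (Φ - Φ * X * Φ) := by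
      rw [Matrix.sub_mul, hXX', Matrix.sub_mul, Matrix.one_mul, Matrix.mul_sub, Matrix.mul_assoc,
        hXX, Matrix.mul_one]
    rw [Matrix.transpose_sub, hsym, hXi, e3, eq_sub_of_add_eq' hkey]
    abel
  rw [e2]
  exact (hX.posSemidef.transpose_mul_mul_same _).add (posSemidef_transpose_mul_self _)

end Inverse

/-! ### The plant DARE and the reduced DARE for `V` -/

namespace Plant

variable {nx nd nu ne : ℕ} {P : Plant nx nd nu ne} {X : Matrix (Fin nx) (Fin nx) ℝ}

theorem norm_eq_one_fullRank (hP : P.DAREConditions) {l : ℂ} (hl : ‖l‖ = 1) {z : Fin nx → ℂ}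
    {w : Fin nu → ℂ} (h1 : P.A.map Complex.ofReal *ᵥ z + P.Bu.map Complex.ofReal *ᵥ w = l • z)
    (h2 : P.Ce.map Complex.ofReal *ᵥ z + P.Deu.map Complex.ofReal *ᵥ w = 0) : z = 0 := by
  obtain ⟨θ, hθ, rfl⟩ : ∃ θ ∈ Set.Icc (0 : ℝ) (2 * Real.pi), Complex.exp (θ * Complex.I) = l := by
    -- The principal argument lies in `(-π, π]`, so it is reduced modulo `2π` into the range of the
    -- rank condition.
    refine ⟨toIcoMod Real.two_pi_pos 0 l.arg, ?_, ?_⟩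
    · have := toIcoMod_mem_Ico Real.two_pi_pos 0 l.arg
      rw [zero_add] at this
      exact Set.Ico_subset_Icc_self this
    · have h := Complex.norm_mul_exp_arg_mul_I l
      rw [hl, Complex.ofReal_one, one_mul] at h
      rw [← h, ← self_sub_toIcoDiv_zsmul]
      rw [Complex.exp_eq_exp_iff_exists_int]
      refine ⟨-toIcoDiv Real.two_pi_pos 0 l.arg, ?_⟩
      push_cast [zsmul_eq_mul]
      rw [h]
      ring
  have hr := hP.fullRank θ hθ
  set M := fromBlocks (P.A.map Complex.ofReal
        - Complex.exp (θ * Complex.I) • (1 : Matrix (Fin nx) (Fin nx) ℂ))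
      (P.Bu.map Complex.ofReal) (P.Ce.map Complex.ofReal) (P.Deu.map Complex.ofReal) with hM
  have hinj : Function.Injective M.mulVecLin := by
    rw [← LinearMap.ker_eq_bot]
    have := M.mulVecLin.finrank_range_add_finrank_ker
    rw [Matrix.rank] at hr
    rw [hr, Module.finrank_fintype_fun_eq_card, Fintype.card_sum, Fintype.card_fin,
      Fintype.card_fin] at this
    exact Submodule.finrank_eq_zero.1 (by omega)
  have h0 : M *ᵥ (Sum.elim z w) = 0 := by
    rw [hM, Matrix.fromBlocks_mulVec, Sum.elim_comp_inl, Sum.elim_comp_inr, h2, Matrix.sub_mulVec,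
      Matrix.smul_mulVec, Matrix.one_mulVec, sub_add_eq_add_sub, h1, sub_self]
    ext (i | i) <;> rfl
  have := hinj (a₁ := Sum.elim z w) (a₂ := 0) (by
    rw [Matrix.mulVecLin_apply, h0, map_zero])
  ext i
  exact congrFun this (Sum.inl i)

theorem exists_isStabilizing (hP : P.DAREConditions) : ∃ X, P.IsStabilizing X :=
  exists_isStabilizingSolution hP.posDef hP.stabilizable fun _ _ _ hl h1 h2 =>
    norm_eq_one_fullRank hP hl h1 h2

theorem IsStabilizing.unique {Y : Matrix (Fin nx) (Fin nx) ℝ} (hR : P.R.PosDef)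
    (hX : P.IsStabilizing X) (hY : P.IsStabilizing Y) : X = Y :=
  IsStabilizingSolution.unique hR hX hY

theorem IsStabilizing.posDef_innovation (hR : P.R.PosDef) (hX : P.IsStabilizing X) :
    (P.R + P.Buᵀ * X * P.Bu).PosDef :=
  RegretControl.posDef_innovation hR hX.posSemidef

theorem IsStabilizing.lyapunov (hR : P.R.PosDef) (hX : P.IsStabilizing X) :
    (P.A11 X)ᵀ * X * P.A11 X + (P.Ce - P.Deu * P.Kx X)ᵀ * (P.Ce - P.Deu * P.Kx X) = X :=
  (IsStabilizingSolution.closedLoop hR hX).symm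

theorem IsStabilizing.orthogonal (hR : P.R.PosDef) (hX : P.IsStabilizing X) :
    (P.A11 X)ᵀ * X * P.Bu + (P.Ce - P.Deu * P.Kx X)ᵀ * P.Deu = 0 :=
  IsStabilizingSolution.orthogonal hR hX

theorem IsStabilizing.orthogonal' (hR : P.R.PosDef) (hX : P.IsStabilizing X) :
    P.Buᵀ * X * P.A11 X + P.Deuᵀ * (P.Ce - P.Deu * P.Kx X) = 0 := by
  have := congrArg Matrix.transpose (hX.orthogonal hR)
  simpa only [Matrix.transpose_add, Matrix.transpose_mul, Matrix.transpose_transpose,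
    hX.posSemidef.transpose_eq, Matrix.transpose_zero, Matrix.mul_assoc] using this

/-- On the kernel of `P.A11 X` the orthogonality relation reduces to `R K_x z = Sᵀ z`. There `P.A11
X` agrees with `A - B_u R⁻¹ Sᵀ`, which is nonsingular. -/
theorem IsStabilizing.isUnit_A11 (hP : P.DAREConditions) (hX : P.IsStabilizing X) :
    IsUnit (P.A11 X) := by
  refine isUnit_of_mulVec_eq_zero fun z hz => ?_
  have h := congrArg (· *ᵥ z) (hX.orthogonal' hP.posDef)
  simp only [Matrix.add_mulVec, ← Matrix.mulVec_mulVec, hz, Matrix.mulVec_zero, zero_add,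
    Matrix.zero_mulVec] at h
  rw [Matrix.mulVec_mulVec, Matrix.mul_sub, Matrix.sub_mulVec, sub_eq_zero] at h
  have hK : P.R⁻¹ *ᵥ (P.Sᵀ *ᵥ z) = P.Kx X *ᵥ z := by
    rw [S, Matrix.transpose_mul, Matrix.transpose_transpose, h, ← Matrix.mul_assoc,
      Matrix.mulVec_mulVec, ← Matrix.mul_assoc]
    change (P.R⁻¹ * P.R * P.Kx X) *ᵥ z = _
    rw [inv_mul_of_isUnit hP.posDef.isUnit, Matrix.one_mul]
  refine Matrix.mulVec_injective_iff_isUnit.2 hP.nonsingular ?_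
  rw [Matrix.mulVec_zero, Matrix.sub_mulVec, Matrix.mul_assoc, ← Matrix.mulVec_mulVec,
    ← Matrix.mulVec_mulVec, hK]
  rwa [A11, Matrix.sub_mulVec, ← Matrix.mulVec_mulVec] at hz

/-- By the Lyapunov equation the kernel of `X` is invariant under the Schur matrix `P.A11 X`. On it
the feedback term `K ᵀ B_dᵀ X` vanishes, so the transpose of the stabilized matrix inverts `P.A11
X`; two Schur maps cannot be mutually inverse on a nonzero vector. -/
theorem IsStabilizing.posDef (hR : P.R.PosDef) (hX : P.IsStabilizing X)
    (hA : IsUnit (P.A11 X)) (hs : Stabilizable ((P.A11 X)⁻¹)ᵀ (X * P.Bd)) : X.PosDef := by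
  refine hX.posSemidef.posDef_of_ker fun z hz => ?_
  obtain ⟨K, hK⟩ := hs
  have hker : ∀ z, X *ᵥ z = 0 → X *ᵥ (P.A11 X *ᵥ z) = 0 := by
    intro z hz
    refine hX.posSemidef.mulVec_eq_zero ?_
    have h := congrArg (fun M => z ⬝ᵥ M *ᵥ z) (hX.lyapunov hR)
    simp only [Matrix.add_mulVec, dotProduct_add, hz, dotProduct_zero] at h
    rw [Matrix.mul_assoc, dotProduct_transpose_mul_mulVec, dotProduct_transpose_mul_mulVec,
      ← Matrix.mulVec_mulVec] at h
    have h1 := hX.posSemidef.dotProduct_nonneg (P.A11 X *ᵥ z)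
    have h2 : 0 ≤ (P.Ce - P.Deu * P.Kx X) *ᵥ z ⬝ᵥ (P.Ce - P.Deu * P.Kx X) *ᵥ z :=
      by simpa using dotProduct_star_self_nonneg ((P.Ce - P.Deu * P.Kx X) *ᵥ z)
    linarith
  refine IsSchur.eq_zero_of_fixed (A := P.A11 X) hX.schur hK.transpose {z | X *ᵥ z = 0} hker ?_ hz
  intro z hz
  rw [Matrix.transpose_sub, Matrix.transpose_transpose, Matrix.sub_mulVec, Matrix.mulVec_mulVec,
    inv_mul_of_isUnit hA, Matrix.one_mulVec, Matrix.transpose_mul, Matrix.transpose_mul,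
    hX.posSemidef.transpose_eq, ← Matrix.mulVec_mulVec, ← Matrix.mulVec_mulVec, hker z hz,
    Matrix.mulVec_zero, Matrix.mulVec_zero, sub_zero]

theorem IsStabilizing.posSemidef_Qtilde (hR : P.R.PosDef) (hX : P.IsStabilizing X)
    (hXd : X.PosDef) (γ : ℝ) : (P.Qtilde X γ).PosSemidef := by
  have h := posSemidef_inv_sub hXd (hX.posDef_innovation hR) (hX.lyapunov hR) (hX.orthogonal hR)
    (add_comm _ _)
  have h2 := h.transpose_mul_mul_same ((P.A11 X)⁻¹)ᵀ
  rw [Matrix.transpose_transpose] at h2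
  exact h2.smul (sq_nonneg γ)

theorem exists_isStabilizingSolution_Qtilde (hR : P.R.PosDef) (hX : P.IsStabilizing X)
    (hA : IsUnit (P.A11 X)) (hs : Stabilizable ((P.A11 X)⁻¹)ᵀ (X * P.Bd)) {γd : ℝ} (hγ : 0 < γd)
    (γJ : ℝ) : ∃ V, IsStabilizingSolution ((P.A11 X)⁻¹)ᵀ (X * P.Bd) (P.Qtilde X γJ)
      (γd ^ 2 • 1) 0 V := by
  obtain ⟨Y, hY⟩ := (hX.posSemidef_Qtilde hR (hX.posDef hR hA hs) γJ).exists_factor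
  -- Stacking a factor of `Q̃` above `γd • 1` realizes the weights as Gram matrices without a cross
  -- term. Zero output then forces zero input, so an invariant zero is an eigenvector of `Â₁₁⁻ᵀ`.
  let C : Matrix (Fin nx ⊕ Fin nd) (Fin nx) ℝ := fromRows Y 0
  let D : Matrix (Fin nx ⊕ Fin nd) (Fin nd) ℝ := fromRows 0 (γd • 1)
  have h1 : Cᵀ * C = P.Qtilde X γJ := by
    simp [C, hY, Matrix.transpose_fromRows, Matrix.fromCols_mul_fromRows]
  have h2 : Dᵀ * D = γd ^ 2 • 1 := by
    simp [D, Matrix.transpose_fromRows, Matrix.fromCols_mul_fromRows, smul_smul, pow_two]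
  have h3 : Cᵀ * D = 0 := by
    simp [C, D, Matrix.transpose_fromRows, Matrix.fromCols_mul_fromRows]
  have hpd : (γd ^ 2 • (1 : Matrix (Fin nd) (Fin nd) ℝ)).PosDef :=
    Matrix.PosDef.one.smul (pow_pos hγ 2)
  rw [← h1, ← h2, ← h3]
  refine exists_isStabilizingSolution (h2 ▸ hpd) hs fun l z w hl e1 e2 => ?_
  have hw : w = 0 := by
    ext i
    have := congrFun e2 (Sum.inr i)
    have hsm : (γd • (1 : Matrix (Fin nd) (Fin nd) ℝ)).map Complex.ofReal =
        (γd : ℂ) • (1 : Matrix (Fin nd) (Fin nd) ℂ) := by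
      ext a b
      by_cases hab : a = b <;> simp [hab]
    simpa [hsm, Matrix.smul_mulVec, C, D, Matrix.fromRows_map, Matrix.fromRows_mulVec, hγ.ne'] using this
  rw [hw, Matrix.mulVec_zero, add_zero] at e1
  have hS : IsSchur (P.A11 X)ᵀ := hX.schur.transpose
  rw [isSchur_iff_eigenvector] at hS
  have hl0 : l ≠ 0 := by rintro rfl; simp at hl
  -- Inverting a unimodular eigenvalue leaves it unimodular, hence excluded from the spectrum of the
  -- Schur matrix `(P.A11 X)ᵀ`.
  refine hS l⁻¹ z ?_ (by rw [norm_inv, hl, inv_one])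
  have hm : (P.A11 X)ᵀ.map Complex.ofReal * ((P.A11 X)⁻¹)ᵀ.map Complex.ofReal = 1 := by
    have := Matrix.map_mul (f := Complex.ofRealHom) (L := (P.A11 X)ᵀ) (M := ((P.A11 X)⁻¹)ᵀ)
    rw [← Matrix.transpose_mul, inv_mul_of_isUnit hA, Matrix.transpose_one] at this
    rw [Matrix.map_one _ (by simp) (by simp)] at this
    exact this.symm
  have := congrArg ((P.A11 X)ᵀ.map Complex.ofReal *ᵥ ·) e1
  simp only [Matrix.mulVec_mulVec, hm, Matrix.one_mulVec, Matrix.mulVec_smul] at this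
  rw [this, smul_smul, inv_mul_cancel₀ hl0, one_smul, ← this]

end Plant

/-! ### The augmented DARE and its block solution -/

namespace Plant

variable {nx nd nu ne : ℕ} {P : Plant nx nd nu ne} {X V : Matrix (Fin nx) (Fin nx) ℝ} {γd γJ : ℝ}

/-- The upper left block is the Lyapunov equation of `X`, the off-diagonal blocks are orthogonality
together with `Â₁₁ᵀ Â₁₁⁻ᵀ = 1`, and the residual of the lower right block is what `Q̃` is designed
to be. -/
theorem Phat_lyapunov (hR : P.R.PosDef) (hX : P.IsStabilizing X)
    (hA : IsUnit (P.A11 X)) :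
    (P.Phat X γd γJ).Aᵀ * (γJ ^ 2 • fromBlocks X 1 1 X⁻¹) * (P.Phat X γd γJ).A +
        (P.Phat X γd γJ).Cᵀ * (P.Phat X γd γJ).C =
      γJ ^ 2 • fromBlocks X 1 1 X⁻¹ + fromBlocks 0 0 0 (P.Qtilde X γJ) := by
  have hXs := hX.posSemidef.transpose_eq
  have hH := hX.posDef_innovation hR
  have hHi : (P.R + P.Buᵀ * X * P.Bu)⁻¹ᵀ = (P.R + P.Buᵀ * X * P.Bu)⁻¹ :=
    hH.inv.posSemidef.transpose_eq
  have hA1 : ((P.A11 X)⁻¹)ᵀᵀ * (P.A11 X) = 1 := by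
    rw [Matrix.transpose_transpose, inv_mul_of_isUnit hA]
  have hA2 : (P.A11 X)ᵀ * ((P.A11 X)⁻¹)ᵀ = 1 := by
    rw [← Matrix.transpose_mul, inv_mul_of_isUnit hA, Matrix.transpose_one]
  have h11 := hX.lyapunov hR
  have h12 := hX.orthogonal hR
  have h21 := hX.orthogonal' hR
  have hRd : P.Deuᵀ * P.Deu = P.R := rfl
  have hQ : P.Qtilde X γJ = γJ ^ 2 • (((P.A11 X)⁻¹)ᵀᵀ *
      (X⁻¹ - P.A11 X * X⁻¹ * (P.A11 X)ᵀ - P.Bu * (P.R + P.Buᵀ * X * P.Bu)⁻¹ * P.Buᵀ) *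
      ((P.A11 X)⁻¹)ᵀ) := by rw [Matrix.transpose_transpose, Qtilde]
  rw [hQ]
  simp only [Phat, Kv]
  generalize ((P.A11 X)⁻¹)ᵀ = A2 at *
  have hHH := mul_inv_of_isUnit hH.isUnit
  generalize hHdef : P.R + P.Buᵀ * X * P.Bu = H at *
  generalize H⁻¹ = Hi at *
  generalize P.A11 X = A1 at *
  generalize P.Ce - P.Deu * P.Kx X = C1 at *
  generalize P.Bu = B at *
  generalize P.Deu = D at *
  have hsm : ∀ Z : Matrix (Fin ne ⊕ Fin nd) (Fin nx ⊕ Fin nx) ℝ,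
      (γJ • Z)ᵀ * (γJ • Z) = γJ ^ 2 • (Zᵀ * Z) := by
    intro Z
    rw [Matrix.transpose_smul, Matrix.smul_mul, Matrix.mul_smul, smul_smul, pow_two]
  have hfb : fromBlocks 0 0 0 (γJ ^ 2 • (A2ᵀ * (X⁻¹ - A1 * X⁻¹ * A1ᵀ - B * Hi * Bᵀ) * A2)) =
      γJ ^ 2 • fromBlocks (0 : Matrix (Fin nx) (Fin nx) ℝ) 0 0
        (A2ᵀ * (X⁻¹ - A1 * X⁻¹ * A1ᵀ - B * Hi * Bᵀ) * A2) := by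
    rw [Matrix.fromBlocks_smul]; simp
  rw [hsm, hfb, Matrix.mul_smul, Matrix.smul_mul, ← smul_add, ← smul_add]
  congr 1
  simp only [Matrix.fromBlocks_transpose, Matrix.fromBlocks_multiply, Matrix.fromBlocks_add,
    Matrix.transpose_zero, Matrix.mul_zero, Matrix.zero_mul, Matrix.mul_one, add_zero]
  have e12 : A1ᵀ * X * -(B * (Hi * Bᵀ) * A2) + A1ᵀ * A2 + C1ᵀ * -(D * (Hi * Bᵀ) * A2) = 1 := by
    rw [hA2]
    have : A1ᵀ * X * -(B * (Hi * Bᵀ) * A2) + 1 + C1ᵀ * -(D * (Hi * Bᵀ) * A2) =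
        1 - (A1ᵀ * X * B + C1ᵀ * D) * (Hi * Bᵀ) * A2 := by
      simp only [Matrix.mul_neg, Matrix.add_mul, Matrix.mul_assoc]; abel
    rw [this, h12, Matrix.zero_mul, Matrix.zero_mul, sub_zero]
  rw [Matrix.fromBlocks_inj]
  refine ⟨h11, e12, ?_, ?_⟩
  · have := congrArg Matrix.transpose e12
    simp only [Matrix.transpose_add, Matrix.transpose_mul, Matrix.transpose_neg,
      Matrix.transpose_transpose, Matrix.transpose_one, hXs, hHi, Matrix.mul_assoc] at this
    simp only [Matrix.transpose_mul, Matrix.transpose_neg, Matrix.transpose_transpose, hHi,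
      Matrix.add_mul, Matrix.mul_assoc]
    exact this
  -- The two quadratic terms share the factor `R + B_uᵀ X B_u = H`, which cancels one `H⁻¹`; the two
  -- cross terms then contribute minus twice the same matrix.
  · have hN : (B * (Hi * Bᵀ) * A2)ᵀ * X * (B * (Hi * Bᵀ) * A2) +
        (D * (Hi * Bᵀ) * A2)ᵀ * (D * (Hi * Bᵀ) * A2) = A2ᵀ * (B * (Hi * Bᵀ)) * A2 := by
      calc _ = A2ᵀ * (B * Hi * ((Dᵀ * D + Bᵀ * X * B) * Hi * Bᵀ)) * A2 := by
            simp only [Matrix.transpose_mul, Matrix.transpose_transpose, hHi, Matrix.add_mul,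
              Matrix.mul_add, Matrix.mul_assoc]
            abel
        _ = _ := by rw [hRd, hHdef, hHH, Matrix.one_mul, Matrix.mul_assoc B]
    have hAX : A2ᵀ * (A1 * X⁻¹ * A1ᵀ) * A2 = X⁻¹ := by
      calc _ = (A2ᵀ * A1) * X⁻¹ * (A1ᵀ * A2) := by simp only [Matrix.mul_assoc]
        _ = _ := by rw [hA1, hA2, Matrix.one_mul, Matrix.mul_one]
    have hgoal : A2ᵀ * (X⁻¹ - A1 * X⁻¹ * A1ᵀ - B * Hi * Bᵀ) * A2 =
        A2ᵀ * X⁻¹ * A2 - X⁻¹ - A2ᵀ * (B * (Hi * Bᵀ)) * A2 := by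
      rw [Matrix.mul_sub, Matrix.mul_sub, Matrix.sub_mul, Matrix.sub_mul, hAX, Matrix.mul_assoc B]
    have hcr : (B * (Hi * Bᵀ) * A2)ᵀ * A2 = A2ᵀ * (B * (Hi * Bᵀ)) * A2 := by
      simp only [Matrix.transpose_mul, Matrix.transpose_transpose, hHi, Matrix.mul_assoc]
    have hcr' : A2ᵀ * (B * (Hi * Bᵀ) * A2) = A2ᵀ * (B * (Hi * Bᵀ)) * A2 := by
      simp only [Matrix.mul_assoc]
    rw [hgoal]
    generalize B * (Hi * Bᵀ) * A2 = N at *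
    generalize D * (Hi * Bᵀ) * A2 = M at *
    rw [← hN] at hcr hcr' ⊢
    simp only [Matrix.transpose_neg, Matrix.neg_mul, Matrix.mul_neg, Matrix.add_mul, neg_neg,
      hcr, hcr']
    abel

theorem Phat_DD : (P.Phat X γd γJ).Dᵀ * (P.Phat X γd γJ).D = γd ^ 2 • 1 := by
  simp [Phat, Matrix.transpose_fromRows, Matrix.fromCols_mul_fromRows, smul_smul, pow_two]

theorem Phat_CD : (P.Phat X γd γJ).Cᵀ * (P.Phat X γd γJ).D = 0 := by
  have : (P.Phat X γd γJ).C = γJ • fromRows (fromCols (P.Ce - P.Deu * P.Kx X)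
      (-(P.Deu * P.Kv X * ((P.A11 X)⁻¹)ᵀ))) 0 := by
    simp only [Phat]
    rw [← Matrix.fromRows_fromCols_eq_fromBlocks, Matrix.fromCols_zero]
  rw [this, Matrix.transpose_smul, Matrix.transpose_fromRows]
  simp [Phat, Matrix.fromCols_mul_fromRows]

/-- The input columns `(B_d, -X B_d)` lie in the kernel of `[[X, 1], [1, X⁻¹]]`, so only `V` sees
the input. -/
theorem Xhat_mul_B (hXd : X.PosDef) :
    Xhat X V γJ * (P.Phat X γd γJ).B = fromRows 0 (-(V * (X * P.Bd))) := by
  simp only [Xhat, Phat, Matrix.add_mul, Matrix.smul_mul, Matrix.fromBlocks_mul_fromRows,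
    Matrix.one_mul, Matrix.mul_neg, Matrix.zero_mul, zero_add]
  rw [← Matrix.mul_assoc X⁻¹, inv_mul_of_isUnit hXd.isUnit, Matrix.one_mul]
  simp

theorem posDef_sq_smul_one {n : ℕ} (hγ : 0 < γd) :
    (γd ^ 2 • (1 : Matrix (Fin n) (Fin n) ℝ)).PosDef :=
  Matrix.PosDef.one.smul (pow_pos hγ 2)

theorem Xhat_gain (hXd : X.PosDef) :
    (P.Phat X γd γJ).Bᵀ * Xhat X V γJ * (P.Phat X γd γJ).B =
      (X * P.Bd)ᵀ * V * (X * P.Bd) ∧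
    (P.Phat X γd γJ).Aᵀ * Xhat X V γJ * (P.Phat X γd γJ).B =
      fromRows 0 (-(((P.A11 X)⁻¹)ᵀᵀ * V * (X * P.Bd))) := by
  constructor
  · rw [Matrix.mul_assoc, Xhat_mul_B hXd]
    simp only [Phat, Matrix.transpose_fromRows, Matrix.fromCols_mul_fromRows, Matrix.mul_zero,
      Matrix.transpose_neg, Matrix.neg_mul, Matrix.mul_neg, neg_neg, zero_add, Matrix.mul_assoc]
  · rw [Matrix.mul_assoc, Xhat_mul_B hXd]
    simp only [Phat, Matrix.fromBlocks_transpose, Matrix.fromBlocks_mul_fromRows, Matrix.mul_zero,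
      Matrix.transpose_zero, Matrix.zero_mul, Matrix.mul_neg, zero_add, neg_zero, Matrix.mul_assoc]

/-- The vanishing first block is why the spectral factor needs only the costate dimension, not that
of the whole augmented state. -/
theorem dareGain_Xhat (hXd : X.PosDef) :
    dareGain (P.Phat X γd γJ).A (P.Phat X γd γJ).B ((P.Phat X γd γJ).Dᵀ * (P.Phat X γd γJ).D)
      ((P.Phat X γd γJ).Cᵀ * (P.Phat X γd γJ).D) (Xhat X V γJ) =
      fromCols 0 (-dareGain ((P.A11 X)⁻¹)ᵀ (X * P.Bd) (γd ^ 2 • 1) 0 V) := by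
  rw [dareGain, (Xhat_gain hXd).1, (Xhat_gain hXd).2, Phat_DD, Phat_CD, add_zero,
    Matrix.transpose_fromRows, Matrix.mul_fromCols, dareGain, add_zero]
  simp

theorem isStabilizingSolution_Xhat (hR : P.R.PosDef) (hX : P.IsStabilizing X) (hXd : X.PosDef)
    (hA : IsUnit (P.A11 X))
    (hV : IsStabilizingSolution ((P.A11 X)⁻¹)ᵀ (X * P.Bd) (P.Qtilde X γJ) (γd ^ 2 • 1) 0 V) :
    IsStabilizingSolution (P.Phat X γd γJ).A (P.Phat X γd γJ).B
      ((P.Phat X γd γJ).Cᵀ * (P.Phat X γd γJ).C) ((P.Phat X γd γJ).Dᵀ * (P.Phat X γd γJ).D)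
      ((P.Phat X γd γJ).Cᵀ * (P.Phat X γd γJ).D) (Xhat X V γJ) := by
  refine ⟨?_, ?_, ?_⟩
  · have h1 : (fromBlocks X 1 1 X⁻¹).PosSemidef := by
      -- Factoring through `[X 1]` with middle weight `X⁻¹` exhibits semidefiniteness.
      have : fromBlocks X 1 1 X⁻¹ = (fromCols X 1)ᵀ * X⁻¹ * fromCols X 1 := by
        rw [Matrix.transpose_fromCols, Matrix.mul_assoc, Matrix.mul_fromCols,
          Matrix.fromRows_mul_fromCols, hX.posSemidef.transpose_eq, inv_mul_of_isUnit hXd.isUnit]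
        simp [mul_inv_of_isUnit hXd.isUnit]
      rw [this]
      exact hXd.inv.posSemidef.transpose_mul_mul_same _
    have h2 : (fromBlocks (0 : Matrix (Fin nx) (Fin nx) ℝ) 0 0 V).PosSemidef := by
      have : fromBlocks (0 : Matrix (Fin nx) (Fin nx) ℝ) 0 0 V =
          (fromCols (0 : Matrix (Fin nx) (Fin nx) ℝ) 1)ᵀ * V *
            fromCols (0 : Matrix (Fin nx) (Fin nx) ℝ) 1 := by
        rw [Matrix.transpose_fromCols, Matrix.mul_assoc, Matrix.mul_fromCols,
          Matrix.fromRows_mul_fromCols]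
        simp
      rw [this]
      exact hV.posSemidef.transpose_mul_mul_same _
    exact (h1.smul (sq_nonneg γJ)).add h2
  · have h0 := hV.dare
    rw [(Xhat_gain hXd).1, (Xhat_gain hXd).2, Phat_DD, Phat_CD, add_zero]
    rw [add_zero] at h0
    have hl := Phat_lyapunov (γd := γd) (γJ := γJ) hR hX hA
    have hdiag : (P.Phat X γd γJ).Aᵀ * fromBlocks 0 0 0 V * (P.Phat X γd γJ).A =
        fromBlocks 0 0 0 (((P.A11 X)⁻¹)ᵀᵀ * V * ((P.A11 X)⁻¹)ᵀ) := by
      simp [Phat, Matrix.fromBlocks_transpose, Matrix.fromBlocks_multiply]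
    have hrank : fromRows (0 : Matrix (Fin nx) (Fin nd) ℝ) (-(((P.A11 X)⁻¹)ᵀᵀ * V * (X * P.Bd))) *
        (γd ^ 2 • 1 + (X * P.Bd)ᵀ * V * (X * P.Bd))⁻¹ *
        (fromRows (0 : Matrix (Fin nx) (Fin nd) ℝ) (-(((P.A11 X)⁻¹)ᵀᵀ * V * (X * P.Bd))))ᵀ =
        fromBlocks 0 0 0 (((P.A11 X)⁻¹)ᵀᵀ * V * (X * P.Bd) *
          (γd ^ 2 • 1 + (X * P.Bd)ᵀ * V * (X * P.Bd))⁻¹ *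
          (((P.A11 X)⁻¹)ᵀᵀ * V * (X * P.Bd))ᵀ) := by
      rw [Matrix.transpose_fromRows, Matrix.fromRows_mul, Matrix.fromRows_mul_fromCols]
      simp
    rw [hrank, Xhat, Matrix.mul_add, Matrix.add_mul, hdiag, eq_sub_of_add_eq hl]
    have hsum : γJ ^ 2 • fromBlocks X 1 1 X⁻¹ + fromBlocks 0 0 0 V -
        (γJ ^ 2 • fromBlocks X 1 1 X⁻¹ + fromBlocks 0 0 0 (P.Qtilde X γJ) -
          (P.Phat X γd γJ).Cᵀ * (P.Phat X γd γJ).C +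
          fromBlocks 0 0 0 (((P.A11 X)⁻¹)ᵀᵀ * V * ((P.A11 X)⁻¹)ᵀ)) -
        (P.Phat X γd γJ).Cᵀ * (P.Phat X γd γJ).C =
        fromBlocks 0 0 0 V - fromBlocks 0 0 0 (((P.A11 X)⁻¹)ᵀᵀ * V * ((P.A11 X)⁻¹)ᵀ) -
          fromBlocks 0 0 0 (P.Qtilde X γJ) := by abel
    rw [hsum]
    ext (i | i) (j | j)
    · simp
    · simp
    · simp
    · simpa using congrFun (congrFun h0 i) j
  · rw [dareGain_Xhat hXd, Matrix.mul_fromCols]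
    have : (P.Phat X γd γJ).A - fromCols ((P.Phat X γd γJ).B * (0 : Matrix (Fin nd) (Fin nx) ℝ)) ((P.Phat X γd γJ).B *
        -dareGain ((P.A11 X)⁻¹)ᵀ (X * P.Bd) (γd ^ 2 • 1) 0 V) =
        fromBlocks (P.A11 X) (-(P.Bu * P.Kv X * ((P.A11 X)⁻¹)ᵀ) +
            P.Bd * dareGain ((P.A11 X)⁻¹)ᵀ (X * P.Bd) (γd ^ 2 • 1) 0 V) 0
          (((P.A11 X)⁻¹)ᵀ - X * P.Bd * dareGain ((P.A11 X)⁻¹)ᵀ (X * P.Bd) (γd ^ 2 • 1) 0 V) := by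
      simp only [Phat, Matrix.mul_zero, Matrix.fromRows_mul]
      ext (i | i) (j | j) <;> simp
    rw [this]
    exact IsSchur.fromBlocks_zero₂₁ hX.schur hV.schur _

end Plant

/-! ### Square-summable signals -/

section L2

variable {n m p : Type*} [Fintype n] [Fintype m] [Fintype p]

theorem isL2_iff {v : ℤ → n → ℝ} : IsL2 v ↔ ∀ i, Summable fun t => v t i ^ 2 := by
  constructor
  · intro h i
    refine Summable.of_nonneg_of_le (fun _ => sq_nonneg _) (fun t => ?_) h
    have := Finset.single_le_sum (f := fun i => v t i * v t i) (fun _ _ => mul_self_nonneg _)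
      (Finset.mem_univ i)
    simpa [dotProduct, pow_two] using this
  · intro h
    have := summable_sum (s := Finset.univ) fun i _ => h i
    simpa [IsL2, dotProduct, pow_two] using this

theorem summable_mul_of_sq {a b : ℤ → ℝ} (ha : Summable fun t => a t ^ 2)
    (hb : Summable fun t => b t ^ 2) : Summable fun t => a t * b t := by
  refine Summable.of_norm_bounded (ha.add hb) fun t => ?_
  rw [Real.norm_eq_abs, abs_le]
  constructor <;> nlinarith [sq_nonneg (a t + b t), sq_nonneg (a t - b t)]

theorem summable_sq_add {a b : ℤ → ℝ} (ha : Summable fun t => a t ^ 2)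
    (hb : Summable fun t => b t ^ 2) : Summable fun t => (a t + b t) ^ 2 := by
  refine ((ha.add hb).add ((summable_mul_of_sq ha hb).mul_left 2)).congr fun t => ?_
  ring

theorem summable_sq_sum {ι : Type*} (s : Finset ι) {a : ι → ℤ → ℝ}
    (ha : ∀ i, Summable fun t => a i t ^ 2) : Summable fun t => (∑ i ∈ s, a i t) ^ 2 := by
  classical
  induction s using Finset.induction_on with
  | empty => simp
  | insert i s hi ih =>
    simp only [Finset.sum_insert hi]
    exact summable_sq_add (ha i) ih

theorem IsL2.add {v w : ℤ → n → ℝ} (hv : IsL2 v) (hw : IsL2 w) : IsL2 fun t => v t + w t :=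
  isL2_iff.2 fun i => summable_sq_add (isL2_iff.1 hv i) (isL2_iff.1 hw i)

theorem IsL2.mulVec {v : ℤ → n → ℝ} (hv : IsL2 v) (M : Matrix m n ℝ) :
    IsL2 fun t => M *ᵥ v t := by
  refine isL2_iff.2 fun i => summable_sq_sum Finset.univ (a := fun j t => M i j * v t j) fun j => ?_
  simpa only [mul_pow] using (isL2_iff.1 hv j).mul_left (M i j ^ 2)

theorem IsL2.neg {v : ℤ → n → ℝ} (hv : IsL2 v) : IsL2 fun t => -v t := by
  simpa [IsL2] using hv

theorem IsL2.sub {v w : ℤ → n → ℝ} (hv : IsL2 v) (hw : IsL2 w) : IsL2 fun t => v t - w t := by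
  simpa only [sub_eq_add_neg] using hv.add hw.neg

theorem IsL2.comp_equiv {v : ℤ → n → ℝ} (hv : IsL2 v) (σ : ℤ ≃ ℤ) : IsL2 fun t => v (σ t) :=
  (Equiv.summable_iff σ (f := fun t => v t ⬝ᵥ v t)).2 hv

theorem IsL2.elim {v : ℤ → n → ℝ} {w : ℤ → m → ℝ} (hv : IsL2 v) (hw : IsL2 w) :
    IsL2 fun t => Sum.elim (v t) (w t) := by
  rw [isL2_iff] at *
  rintro (i | i)
  · exact hv i
  · exact hw i

theorem IsL2.smul {v : ℤ → n → ℝ} (hv : IsL2 v) (c : ℝ) : IsL2 fun t => c • v t :=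
  isL2_iff.2 fun i => by
    simpa only [Pi.smul_apply, smul_eq_mul, mul_pow] using (isL2_iff.1 hv i).mul_left (c ^ 2)

theorem IsL2.summable_dotProduct {v w : ℤ → n → ℝ} (hv : IsL2 v) (hw : IsL2 w) :
    Summable fun t => v t ⬝ᵥ w t :=
  summable_sum fun i _ => summable_mul_of_sq (isL2_iff.1 hv i) (isL2_iff.1 hw i)

theorem IsL2.tendsto_cofinite {v : ℤ → n → ℝ} (hv : IsL2 v) : Tendsto v cofinite (𝓝 0) := by
  rw [tendsto_pi_nhds]
  intro i
  have := (isL2_iff.1 hv i).tendsto_cofinite_zero.sqrt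
  rw [Real.sqrt_zero] at this
  exact (tendsto_zero_iff_abs_tendsto_zero _).2 (this.congr fun t => Real.sqrt_sq_eq_abs _)

theorem IsL2.tendsto_atBot {v : ℤ → n → ℝ} (hv : IsL2 v) : Tendsto v atBot (𝓝 0) :=
  hv.tendsto_cofinite.mono_left (Int.cofinite_eq ▸ le_sup_left)

theorem IsL2.tendsto_atTop {v : ℤ → n → ℝ} (hv : IsL2 v) : Tendsto v atTop (𝓝 0) :=
  hv.tendsto_cofinite.mono_left (Int.cofinite_eq ▸ le_sup_right)

/-- Sums over `ℤ` are shift invariant, so a summable storage term cancels with no boundary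
contributions. -/
theorem tsum_eq_of_telescope {a b s : ℤ → ℝ} (ha : Summable a) (hb : Summable b) (hs : Summable s)
    (h : ∀ t, a t + s (t + 1) = b t + s t) : ∑' t, a t = ∑' t, b t := by
  have hs1 : Summable fun t => s (t + 1) := (Equiv.summable_iff (Equiv.addRight (1 : ℤ)) (f := s)).2 hs
  have h1 : ∑' t, s (t + 1) = ∑' t, s t := (Equiv.addRight (1 : ℤ)).tsum_eq s
  have h2 := tsum_congr (L := .unconditional ℤ) h
  rw [ha.tsum_add hs1, hb.tsum_add hs, h1] at h2
  exact add_right_cancel h2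

/-- Young's inequality: the convolution of an absolutely summable kernel with a square-summable
signal is square summable. -/
theorem summable_conv {h : ℕ → ℝ} {g : ℤ → ℝ} (hh : Summable fun k => |h k|)
    (hg : Summable fun t => g t ^ 2) :
    (∀ t : ℤ, Summable fun k : ℕ => h k * g (t - k)) ∧
      Summable fun t : ℤ => (∑' k : ℕ, h k * g (t - k)) ^ 2 := by
  have hbd : ∀ t, g t ^ 2 ≤ ∑' t, g t ^ 2 := fun t => hg.le_tsum t fun _ _ => sq_nonneg _
  have h1 : ∀ t : ℤ, Summable fun k : ℕ => h k * g (t - k) := by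
    intro t
    refine Summable.of_norm_bounded (hh.mul_right (1 + ∑' t, g t ^ 2)) fun k => ?_
    rw [norm_mul, Real.norm_eq_abs, Real.norm_eq_abs]
    refine mul_le_mul_of_nonneg_left ?_ (abs_nonneg _)
    have := hbd (t - k)
    rw [abs_le]
    constructor <;> nlinarith [sq_nonneg (g (t - k) - 1), sq_nonneg (g (t - k) + 1)]
  have hprod : Summable fun q : ℤ × ℕ => |h q.2| * g (q.1 - q.2) ^ 2 := by
    have h0 : Summable fun q : ℕ × ℤ => |h q.1| * g q.2 ^ 2 :=
      hh.mul_of_nonneg hg (fun _ => abs_nonneg _) fun _ => sq_nonneg _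
    -- The shear `(t, k) ↦ (k, t - k)` turns the convolution kernel into a product of summable
    -- families.
    let σ : ℤ × ℕ ≃ ℕ × ℤ :=
      { toFun := fun q => (q.2, q.1 - q.2)
        invFun := fun q => (q.2 + q.1, q.1)
        left_inv := fun q => by simp
        right_inv := fun q => by simp }
    exact (Equiv.summable_iff σ (f := fun q : ℕ × ℤ => |h q.1| * g q.2 ^ 2)).2 h0
  have hp : Summable fun t : ℤ => ∑' k : ℕ, |h k| * g (t - k) ^ 2 := hprod.prod
  refine ⟨h1, (hp.mul_left (∑' k, |h k|)).of_nonneg_of_le (fun _ => sq_nonneg _) fun t => ?_⟩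
  have h2 : Summable fun k : ℕ => |h k| * g (t - k) ^ 2 := hprod.prod_factor t
  have h3 := Tendsto.pow (h1 t).hasSum 2
  have h4 := Tendsto.mul hh.hasSum h2.hasSum
  refine le_of_tendsto_of_tendsto' h3 h4 fun s => ?_
  -- Cauchy–Schwarz with weights `|h k|`, on finite sums before passing to the limit.
  refine Finset.sum_sq_le_sum_mul_sum_of_sq_le_mul s (fun _ _ => abs_nonneg _)
    (fun _ _ => mul_nonneg (abs_nonneg _) (sq_nonneg _)) fun k _ => le_of_eq ?_
  rw [mul_pow, ← mul_assoc, abs_mul_abs_self, pow_two (h k)]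

variable [DecidableEq n]

/-- Here `x T = A ^ k x (T - k)` for every `k`. Only times before `T` are involved, which is what
causality needs. -/
theorem eq_zero_of_forward {A : Matrix n n ℝ} (hA : IsSchur A) {x : ℤ → n → ℝ} {T : ℤ}
    (hx : ∀ t < T, x (t + 1) = A *ᵥ x t) (h0 : Tendsto x atBot (𝓝 0)) : x T = 0 := by
  have hk : ∀ k : ℕ, A ^ k *ᵥ x (T - k) = x T := by
    intro k
    induction k with
    | zero => simp
    | succ k ih =>
      rw [← ih, pow_succ, ← Matrix.mulVec_mulVec, ← hx _ (by push_cast; omega)]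
      congr 2
      push_cast
      ring
  have hc : Continuous fun q : Matrix n n ℝ × (n → ℝ) => q.1 *ᵥ q.2 := by fun_prop
  have hT : Tendsto (fun k : ℕ => T - (k : ℤ)) atTop atBot :=
    tendsto_atBot_add_const_left _ T (tendsto_neg_atTop_atBot.comp tendsto_natCast_atTop_atTop)
  have ht := (hc.tendsto (0, 0)).comp (hA.tendsto_pow.prodMk_nhds (h0.comp hT))
  simp only [Function.comp_def, hk, Matrix.zero_mulVec] at ht
  exact tendsto_nhds_unique tendsto_const_nhds ht

theorem eq_of_forward {A : Matrix n n ℝ} (hA : IsSchur A) {x y g : ℤ → n → ℝ}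
    (hx : ∀ t, x (t + 1) = A *ᵥ x t + g t) (hy : ∀ t, y (t + 1) = A *ᵥ y t + g t)
    (hx0 : Tendsto x atBot (𝓝 0)) (hy0 : Tendsto y atBot (𝓝 0)) : x = y := by
  ext1 T
  refine sub_eq_zero.1 (eq_zero_of_forward hA (x := fun t => x t - y t) (T := T) (fun t _ => ?_) ?_)
  · rw [hx, hy, Matrix.mulVec_sub]; abel
  · simpa using hx0.sub hy0

theorem eq_of_backward {A : Matrix n n ℝ} (hA : IsSchur A) {x y g : ℤ → n → ℝ}
    (hx : ∀ t, x t = A *ᵥ x (t + 1) + g t) (hy : ∀ t, y t = A *ᵥ y (t + 1) + g t)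
    (hx0 : Tendsto x atTop (𝓝 0)) (hy0 : Tendsto y atTop (𝓝 0)) : x = y := by
  have := eq_of_forward hA (x := fun t => x (-t)) (y := fun t => y (-t))
    (g := fun t => g (-(t + 1))) (fun t => by rw [hx (-(t + 1))]; congr 3; ring)
    (fun t => by rw [hy (-(t + 1))]; congr 3; ring)
    (hx0.comp tendsto_neg_atBot_atTop) (hy0.comp tendsto_neg_atBot_atTop)
  ext1 t
  simpa using congrFun this (-t)

theorem exists_forward {A : Matrix n n ℝ} (hA : IsSchur A) {g : ℤ → n → ℝ} (hg : IsL2 g) :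
    ∃ x : ℤ → n → ℝ, IsL2 x ∧ ∀ t, x (t + 1) = A *ᵥ x t + g t := by
  have hc := fun i j => summable_conv (hA.summable_abs i j) (isL2_iff.1 hg j)
  -- Variation of constants, `x t = ∑ₖ A ^ k g (t - 1 - k)`, written entrywise so that Young's
  -- inequality applies to each scalar kernel.
  refine ⟨fun t i => ∑ j, ∑' k : ℕ, (A ^ k) i j * g (t - 1 - k) j, isL2_iff.2 fun i => ?_, ?_⟩
  · refine summable_sq_sum Finset.univ fun j => ?_
    exact (Equiv.summable_iff (Equiv.subRight (1 : ℤ))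
      (f := fun t => (∑' k : ℕ, (A ^ k) i j * g (t - k) j) ^ 2)).2 (hc i j).2
  · intro t
    ext i
    have h1 : ∀ j, ∑' k : ℕ, (A ^ k) i j * g (t + 1 - 1 - k) j =
        (1 : Matrix n n ℝ) i j * g t j +
          ∑ l, A i l * ∑' k : ℕ, (A ^ k) l j * g (t - 1 - k) j := by
      intro j
      rw [((hc i j).1 (t + 1 - 1)).tsum_eq_zero_add]
      congr 1
      · simp
      · have h2 : ∀ k : ℕ, (A ^ (k + 1)) i j * g (t + 1 - 1 - (k + 1 : ℕ)) j =
            ∑ l, A i l * ((A ^ k) l j * g (t - 1 - k) j) := by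
          intro k
          rw [pow_succ', Matrix.mul_apply, Finset.sum_mul]
          refine Finset.sum_congr rfl fun l _ => ?_
          rw [mul_assoc]
          congr 3
          push_cast
          ring_nf
        simp only [h2]
        rw [Summable.tsum_finsetSum fun l _ => ((hc l j).1 (t - 1)).mul_left (A i l)]
        simp only [tsum_mul_left]
    simp only [h1, Finset.sum_add_distrib, Pi.add_apply, Matrix.mulVec, dotProduct,
      Finset.mul_sum]
    rw [add_comm, Finset.sum_comm]
    congr 1
    simp [Matrix.one_apply]

theorem exists_backward {A : Matrix n n ℝ} (hA : IsSchur A) {g : ℤ → n → ℝ} (hg : IsL2 g) :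
    ∃ x : ℤ → n → ℝ, IsL2 x ∧ ∀ t, x t = A *ᵥ x (t + 1) + g t := by
  -- Time reversal; the shift by one accounts for `g t` entering at the earlier endpoint of the
  -- step.
  obtain ⟨y, hy, hy'⟩ := exists_forward hA (g := fun t => g (-(t + 1)))
    (hg.comp_equiv ((Equiv.addRight 1).trans (Equiv.neg ℤ)))
  refine ⟨fun t => y (-t), hy.comp_equiv (Equiv.neg ℤ), fun t => ?_⟩
  have := hy' (-(t + 1))
  simpa using this

end L2

/-! ### Stable systems -/

namespace LTI

variable {n m p : Type*} [Fintype n] [DecidableEq n] [Fintype m]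

theorem IsStable.exists_state {F : LTI n m p} (hF : F.IsStable) {d : ℤ → m → ℝ} (hd : IsL2 d) :
    ∃ x : ℤ → n → ℝ, IsL2 x ∧ ∀ t, x (t + 1) = F.A *ᵥ x t + F.B *ᵥ d t :=
  exists_forward hF (hd.mulVec F.B)

/-- The state of a stable system with square-summable input is square summable. -/
theorem IsStable.isL2_state {F : LTI n m p} (hF : F.IsStable) {d : ℤ → m → ℝ} (hd : IsL2 d)
    {x : ℤ → n → ℝ} (hx : ∀ t, x (t + 1) = F.A *ᵥ x t + F.B *ᵥ d t)
    (h0 : Tendsto x atBot (𝓝 0)) : IsL2 x := by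
  obtain ⟨y, hy, hy'⟩ := hF.exists_state hd
  rwa [eq_of_forward hF hx hy' h0 hy.tendsto_atBot]

theorem IsStable.isL2Operator [Fintype p] {F : LTI n m p} (hF : F.IsStable) : F.IsL2Operator := by
  intro d hd
  obtain ⟨x, hx, hx'⟩ := hF.exists_state hd
  refine ⟨fun t => F.C *ᵥ x t + F.D *ᵥ d t, (hx.mulVec _).add (hd.mulVec _), fun e' => ⟨?_, ?_⟩⟩
  · rintro ⟨y, ⟨hy, he⟩, h0⟩
    ext1 t
    rw [he, eq_of_forward hF hy hx' h0 hx.tendsto_atBot]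
  · rintro rfl
    exact ⟨x, ⟨hx', fun t => rfl⟩, hx.tendsto_atBot⟩

theorem IsStable.isCausal {F : LTI n m p} (hF : F.IsStable) : F.IsCausal := by
  rintro T d e e' - ⟨x, ⟨hx, he⟩, h0⟩ ⟨x', ⟨hx', he'⟩, h0'⟩
  ext1 t
  by_cases ht : t ≤ T
  · have hxt : x t = x' t := by
      refine sub_eq_zero.1 (eq_zero_of_forward hF (x := fun t => x t - x' t) (T := t)
        (fun s hs => ?_) ?_)
      · rw [hx, hx', trunc, if_pos (hs.le.trans ht), Matrix.mulVec_sub]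
        abel
      · simpa using h0.sub h0'
    simp only [trunc, if_pos ht, he, he', hxt]
  · simp only [trunc, if_neg ht]

end LTI

/-! ### Spectral factorization -/

section SpectralFactor

variable {n m : Type*} [Fintype n] [DecidableEq n] [Fintype m] [DecidableEq m]

omit [DecidableEq n] [Fintype m] [DecidableEq m] in
theorem transpose_mul_weight_mul {k l : Type*} (T M : Matrix n n ℝ) (U : Matrix n k ℝ)
    (V : Matrix n l ℝ) : (T * U)ᵀ * M * (T * V) = Uᵀ * (Tᵀ * M * T) * V := by
  simp only [Matrix.transpose_mul, Matrix.mul_assoc]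

/-- Let `A₂` be the inverse transpose of a Schur matrix and `A₂ - b K` be Schur. The anticausal error system
`v⁺ = A₂ v - b d`, `i = d - K v` with weight `H` has an observer `s⁺ = A₂ s + L (d - K s) - b d`
whose error dynamics `A₂ - L K` are Schur and whose weighted innovation `c (d - K s)` has the
energy of `i` up to the storage `M`. -/
theorem exists_lossless_observer {A₁ A₂ : Matrix n n ℝ} {b : Matrix n m ℝ} {K : Matrix m n ℝ}
    {H : Matrix m m ℝ} (hA : IsSchur A₁) (h12 : A₁ᵀ * A₂ = 1) (hK : IsSchur (A₂ - b * K))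
    (hH : H.PosDef) :
    ∃ (M : Matrix n n ℝ) (L : Matrix n m ℝ) (c : Matrix m m ℝ), Mᵀ = M ∧ IsUnit c ∧
      IsSchur (A₂ - L * K) ∧ (A₂ - L * K)ᵀ * M * (A₂ - L * K) + (c * K)ᵀ * (c * K) = M ∧
      (A₂ - L * K)ᵀ * M * (-L) + (c * K)ᵀ * c = 0 ∧ (-L)ᵀ * M * (-L) + cᵀ * c = H := by
  have h21 : A₂ * A₁ᵀ = 1 := mul_eq_one_comm.1 h12
  have h12' : A₂ᵀ * A₁ = 1 := by
    have := congrArg Matrix.transpose h12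
    simpa using this
  -- Conjugating this equation by `A₂` gives `A₂ᵀ M A₂ = M + Kᵀ H K`, which is stated with the
  -- unstable `A₂` but solvable because `A₁` is Schur.
  obtain ⟨M, hM, hMl⟩ := exists_lyapunov hA.transpose
    (hH.posSemidef.transpose_mul_mul_same (K * A₁ᵀ))
  rw [Matrix.transpose_transpose] at hMl
  have hMs := hM.transpose_eq
  have hHs := hH.posSemidef.transpose_eq
  have hMd : M.PosDef := by
    refine hM.posDef_of_ker fun z hz => ?_
    have hker : ∀ z, M *ᵥ z = 0 → M *ᵥ (A₁ᵀ *ᵥ z) = 0 ∧ K *ᵥ (A₁ᵀ *ᵥ z) = 0 := by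
      intro z hz
      have h := congrArg (fun N => z ⬝ᵥ N *ᵥ z) hMl
      have e1 : z ⬝ᵥ (A₁ * M * A₁ᵀ) *ᵥ z = (A₁ᵀ *ᵥ z) ⬝ᵥ M *ᵥ (A₁ᵀ *ᵥ z) := by
        rw [← Matrix.mulVec_mulVec, ← Matrix.mulVec_mulVec, ← dotProduct_transpose_mulVec,
          Matrix.transpose_transpose]
      have e2 : z ⬝ᵥ ((K * A₁ᵀ)ᵀ * H * (K * A₁ᵀ)) *ᵥ z =
          (K *ᵥ (A₁ᵀ *ᵥ z)) ⬝ᵥ H *ᵥ (K *ᵥ (A₁ᵀ *ᵥ z)) := by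
        rw [← Matrix.mulVec_mulVec, ← Matrix.mulVec_mulVec, dotProduct_transpose_mulVec,
          ← Matrix.mulVec_mulVec]
      simp only [Matrix.add_mulVec, dotProduct_add, hz, dotProduct_zero, e1, e2] at h
      have p1 := hM.dotProduct_nonneg (A₁ᵀ *ᵥ z)
      have p2 := hH.posSemidef.dotProduct_nonneg (K *ᵥ (A₁ᵀ *ᵥ z))
      refine ⟨hM.mulVec_eq_zero (by linarith), ?_⟩
      have h0 := hH.posSemidef.mulVec_eq_zero (z := K *ᵥ (A₁ᵀ *ᵥ z)) (by linarith)
      exact Matrix.mulVec_injective_iff_isUnit.2 hH.isUnit (by rw [h0, Matrix.mulVec_zero])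
    -- On the kernel of `M` the matrix `K A₁ᵀ` vanishes, so the Schur matrix `A₂ - b K` inverts
    -- `A₁ᵀ` there.
    refine IsSchur.eq_zero_of_fixed hA.transpose hK {z | M *ᵥ z = 0} (fun z hz => (hker z hz).1)
      (fun z hz => ?_) hz
    rw [Matrix.sub_mulVec, Matrix.mulVec_mulVec, h21, Matrix.one_mulVec, ← Matrix.mulVec_mulVec,
      (hker z hz).2, Matrix.mulVec_zero, sub_zero]
  have hNd : (M + Kᵀ * H * K).PosDef :=
    hMd.add_posSemidef (hH.posSemidef.transpose_mul_mul_same K)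
  obtain ⟨N, hN⟩ : ∃ N, N = M + Kᵀ * H * K := ⟨_, rfl⟩
  rw [← hN] at hNd
  have hNi : N⁻¹ᵀ = N⁻¹ := hNd.inv.posSemidef.transpose_eq
  have hNN := mul_inv_of_isUnit hNd.isUnit
  have hNN' := inv_mul_of_isUnit hNd.isUnit
  have hMN : M = A₁ * N * A₁ᵀ := by
    nth_rewrite 1 [hMl]
    rw [hN, Matrix.transpose_mul, Matrix.transpose_transpose]
    simp only [Matrix.mul_add, Matrix.add_mul, Matrix.mul_assoc]
  have hA2M : A₂ᵀ * M * A₂ = N := by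
    rw [hMN]
    calc A₂ᵀ * (A₁ * N * A₁ᵀ) * A₂ = (A₂ᵀ * A₁) * N * (A₁ᵀ * A₂) := by
          simp only [Matrix.mul_assoc]
      _ = N := by rw [h12', h12, Matrix.one_mul, Matrix.mul_one]
  have hKHK : Kᵀ * H * K = N - M := by rw [hN]; abel
  have hE : (H⁻¹ + K * M⁻¹ * Kᵀ).PosDef := by
    have := hMd.inv.posSemidef.transpose_mul_mul_same Kᵀ
    rw [Matrix.transpose_transpose] at this
    exact hH.inv.add_posSemidef this
  obtain ⟨c, hc, hcu⟩ := hE.inv.exists_factor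
  -- Woodbury's identity. Defining `c` through the inverse of `H⁻¹ + K M⁻¹ Kᵀ` makes `H - H K N⁻¹ Kᵀ
  -- H` visibly positive definite.
  have hW : cᵀ * c = H - H * K * N⁻¹ * Kᵀ * H := by
    rw [← hc, Matrix.add_mul_mul_inv_eq_sub _ _ _ _ hH.inv.isUnit hMd.inv.isUnit,
      Matrix.nonsing_inv_nonsing_inv _ ((Matrix.isUnit_iff_isUnit_det _).1 hH.isUnit),
      Matrix.nonsing_inv_nonsing_inv _ ((Matrix.isUnit_iff_isUnit_det _).1 hMd.isUnit), ← hN]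
    rw [Matrix.nonsing_inv_nonsing_inv _ ((Matrix.isUnit_iff_isUnit_det _).1 hMd.isUnit),
      Matrix.nonsing_inv_nonsing_inv _ ((Matrix.isUnit_iff_isUnit_det _).1 hH.isUnit), ← hN]
    exact hNd.isUnit
  have hAL : A₂ - A₂ * N⁻¹ * Kᵀ * H * K = A₂ * N⁻¹ * M := by
    calc _ = A₂ * (N⁻¹ * N) - A₂ * N⁻¹ * (Kᵀ * H * K) := by
          rw [hNN', Matrix.mul_one]; simp only [Matrix.mul_assoc]
      _ = _ := by rw [hKHK, Matrix.mul_sub, Matrix.mul_assoc A₂ N⁻¹ N]; abel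
  have hgram : (A₂ * N⁻¹)ᵀ * M * (A₂ * N⁻¹) = N⁻¹ := by
    calc (A₂ * N⁻¹)ᵀ * M * (A₂ * N⁻¹) = (N⁻¹ * (A₂ᵀ * M * A₂)) * N⁻¹ := by
          simp only [Matrix.transpose_mul, hNi, Matrix.mul_assoc]
      _ = N⁻¹ := by rw [hA2M, hNN', Matrix.one_mul]
  have hcK : Kᵀ * (cᵀ * c) = M * N⁻¹ * Kᵀ * H := by
    calc Kᵀ * (cᵀ * c) = Kᵀ * H - (Kᵀ * H * K) * N⁻¹ * Kᵀ * H := by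
          rw [hW, Matrix.mul_sub]; simp only [Matrix.mul_assoc]
      _ = _ := by
          rw [hKHK]
          simp only [Matrix.sub_mul]
          rw [hNN, Matrix.one_mul]
          abel
  -- With this observer gain the error matrix is `A₂ N⁻¹ M = M⁻¹ A₁ M`, similar to `A₁`: the
  -- eigenvalues of `A₂` are reflected into the disc.
  refine ⟨M, A₂ * N⁻¹ * Kᵀ * H, c, hMs, hcu, ?_, ?_, ?_, ?_⟩
  · have : A₂ * N⁻¹ * M = M⁻¹ * A₁ * M := by
      congr 1
      have h1 : M * A₂ = A₁ * N := by
        rw [hMN, Matrix.mul_assoc, h12, Matrix.mul_one]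
      calc A₂ * N⁻¹ = M⁻¹ * (M * A₂) * N⁻¹ := by
            rw [← Matrix.mul_assoc, inv_mul_of_isUnit hMd.isUnit, Matrix.one_mul]
        _ = M⁻¹ * A₁ := by
            rw [h1, Matrix.mul_assoc, Matrix.mul_assoc, hNN, Matrix.mul_one]
    rw [hAL, this]
    exact hA.similar (mul_inv_of_isUnit hMd.isUnit)
  · rw [hAL, transpose_mul_weight_mul, hgram, hMs, Matrix.transpose_mul, Matrix.mul_assoc Kᵀ, ← Matrix.mul_assoc cᵀ,
      ← Matrix.mul_assoc Kᵀ, hcK]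
    calc M * N⁻¹ * M + M * N⁻¹ * Kᵀ * H * K = M * N⁻¹ * (M + Kᵀ * H * K) := by
          simp only [Matrix.mul_add, Matrix.mul_assoc]
      _ = M := by rw [← hN, Matrix.mul_assoc, hNN', Matrix.mul_one]
  · have e : A₂ * N⁻¹ * Kᵀ * H = A₂ * N⁻¹ * (Kᵀ * H) := by simp only [Matrix.mul_assoc]
    rw [hAL, Matrix.mul_neg, e, transpose_mul_weight_mul, hgram, hMs, Matrix.transpose_mul, Matrix.mul_assoc Kᵀ, hcK]
    simp only [Matrix.mul_assoc]
    abel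
  · have e : A₂ * N⁻¹ * Kᵀ * H = A₂ * N⁻¹ * (Kᵀ * H) := by simp only [Matrix.mul_assoc]
    rw [Matrix.mul_neg, Matrix.transpose_neg, Matrix.neg_mul, Matrix.neg_mul, neg_neg, e, transpose_mul_weight_mul, hgram,
      hW, Matrix.transpose_mul, Matrix.transpose_transpose, hHs]
    simp only [Matrix.mul_assoc]
    abel

/-- The observer of an anticausal system as a causal spectral factor, together with its inverse. -/
theorem exists_spectral_factor {A₁ A₂ : Matrix n n ℝ} {b : Matrix n m ℝ} {K : Matrix m n ℝ}
    {H : Matrix m m ℝ} (hA : IsSchur A₁) (h12 : A₁ᵀ * A₂ = 1) (hK : IsSchur (A₂ - b * K))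
    (hH : H.PosDef) :
    ∃ F G : LTI n m m, F.IsStable ∧ G.IsStable ∧ F.IsInverse G ∧
      ∀ (d f : ℤ → m → ℝ) (v : ℤ → n → ℝ), IsL2 d → F.Maps d f → IsL2 v →
        (∀ t, v (t + 1) = A₂ *ᵥ v t - b *ᵥ d t) →
        normSq f = ∑' t, (d t - K *ᵥ v t) ⬝ᵥ H *ᵥ (d t - K *ᵥ v t) := by
  obtain ⟨M, L, c, hM, hc, hS, e11, e12, e22⟩ := exists_lossless_observer hA h12 hK hH
  have hcc := mul_inv_of_isUnit hc
  have hcc' := inv_mul_of_isUnit hc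
  -- The inverse keeps the observer state `s` and its boundary condition; eliminating `d = K s + c⁻¹
  -- e` cancels `L` and leaves `A₂ - b K`.
  refine ⟨⟨A₂ - L * K, L - b, -(c * K), c⟩, ⟨A₂ - b * K, (L - b) * c⁻¹, K, c⁻¹⟩, hS, hK, ?_, ?_⟩
  · rintro d e - -
    refine exists_congr fun s => and_congr_left fun _ => ?_
    have hout : (∀ t, e t = -(c * K) *ᵥ s t + c *ᵥ d t) ↔ ∀ t, d t = K *ᵥ s t + c⁻¹ *ᵥ e t := by
      refine forall_congr' fun t => ⟨fun h => ?_, fun h => ?_⟩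
      · rw [h, Matrix.mulVec_add, Matrix.mulVec_mulVec, Matrix.mulVec_mulVec, hcc',
          Matrix.mul_neg, ← Matrix.mul_assoc, hcc', Matrix.one_mul, Matrix.neg_mulVec,
          Matrix.one_mulVec, add_neg_cancel_left]
      · rw [h, Matrix.mulVec_add, Matrix.mulVec_mulVec, Matrix.mulVec_mulVec, hcc,
          Matrix.neg_mulVec, Matrix.one_mulVec, neg_add_cancel_left]
    simp only [LTI.Trajectory]
    rw [hout]
    refine and_congr_left fun h => forall_congr' fun t => ?_
    refine Eq.congr rfl ?_
    nth_rewrite 1 [h t]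
    simp only [Matrix.sub_mulVec, Matrix.mulVec_add, ← Matrix.mulVec_mulVec]
    abel
  · rintro d f v hd ⟨s, ⟨hs, hf⟩, hs0⟩ hv hvd
    have hsL : IsL2 s := LTI.IsStable.isL2_state (F := ⟨A₂ - L * K, L - b, -(c * K), c⟩) hS hd hs hs0
    have hw := hv.sub hsL
    have hi := hd.sub (hv.mulVec K)
    have hfL : IsL2 f := by
      have := (hsL.mulVec (-(c * K))).add (hd.mulVec c)
      rwa [show f = fun t => -(c * K) *ᵥ s t + c *ᵥ d t from funext hf]
    -- The observer error `v - s` obeys the lossless system driven by `d - K v`, and its `M`-energy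
    -- is the storage that telescopes.
    refine tsum_eq_of_telescope (s := fun t => (v t - s t) ⬝ᵥ M *ᵥ (v t - s t)) hfL
      (hi.summable_dotProduct (hi.mulVec H)) (hw.summable_dotProduct (hw.mulVec M)) fun t => ?_
    have hb := energy_balance hM e11 e12 e22 (v t - s t) (d t - K *ᵥ v t)
    have e1 : f t = (c * K) *ᵥ (v t - s t) + c *ᵥ (d t - K *ᵥ v t) := by
      rw [hf]
      simp only [Matrix.neg_mulVec, Matrix.mulVec_sub, ← Matrix.mulVec_mulVec]
      abel
    have e2 : v (t + 1) - s (t + 1) =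
        (A₂ - L * K) *ᵥ (v t - s t) + (-L) *ᵥ (d t - K *ᵥ v t) := by
      rw [hvd, hs]
      simp only [Matrix.neg_mulVec, Matrix.mulVec_sub, Matrix.sub_mulVec, ← Matrix.mulVec_mulVec]
      abel
    simp only [e1, e2]
    exact hb

end SpectralFactor

/-! ### The closed loop with the non-causal controller -/

namespace Plant

variable {nx nd nu ne : ℕ} {P : Plant nx nd nu ne} {X : Matrix (Fin nx) (Fin nx) ℝ}
  {d : ℤ → Fin nd → ℝ} {x v x' v' : ℤ → Fin nx → ℝ} {u u' : ℤ → Fin nu → ℝ}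
  {e e' : ℤ → Fin ne → ℝ}

theorem ClosedLoop.state_eq (h : P.ClosedLoop X d x v u e) (t : ℤ) :
    x (t + 1) = P.A11 X *ᵥ x t +
      (P.Bd *ᵥ d t - P.Bu *ᵥ (P.Kv X *ᵥ v (t + 1)) - P.Bu *ᵥ (P.Kd X *ᵥ d t)) := by
  rw [h.state, h.control, A11]
  simp only [Matrix.sub_mulVec, Matrix.mulVec_sub, Matrix.mulVec_neg, ← Matrix.mulVec_mulVec]
  abel

theorem ClosedLoop.costate_eq (h : P.ClosedLoop X d x v u e) (t : ℤ) :
    v t = (P.A11 X)ᵀ *ᵥ v (t + 1) + (P.A11 X)ᵀ *ᵥ ((X * P.Bd) *ᵥ d t) := by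
  rw [h.costate, Matrix.mulVec_add]

/-- The costate equation does not involve the state, so it is solved backward by itself; the state
equation then runs forward. -/
theorem ClosedLoop.unique (hX : P.IsStabilizing X) (h : P.ClosedLoop X d x v u e)
    (h' : P.ClosedLoop X d x' v' u' e') : x' = x ∧ v' = v ∧ u' = u ∧ e' = e := by
  have hA : IsSchur (P.A11 X) := hX.schur
  obtain rfl : v' = v :=
    eq_of_backward hA.transpose h'.costate_eq h.costate_eq h'.costate_final h.costate_final
  obtain rfl : x' = x := eq_of_forward hA h'.state_eq h.state_eq h'.state_init h.state_init
  obtain rfl : u' = u := funext fun t => by rw [h.control, h'.control]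
  exact ⟨rfl, rfl, rfl, funext fun t => by rw [h.error, h'.error]⟩

theorem exists_closedLoop (hX : P.IsStabilizing X) (hd : IsL2 d) :
    ∃ x v u e, P.ClosedLoop X d x v u e ∧ IsL2 x ∧ IsL2 v ∧ IsL2 e := by
  have hA : IsSchur (P.A11 X) := hX.schur
  obtain ⟨v, hv, hv'⟩ := exists_backward hA.transpose ((hd.mulVec (X * P.Bd)).mulVec (P.A11 X)ᵀ)
  have hv1 : IsL2 fun t => v (t + 1) := hv.comp_equiv (Equiv.addRight 1)
  obtain ⟨x, hx, hx'⟩ := exists_forward hA (((hd.mulVec P.Bd).sub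
    ((hv1.mulVec (P.Kv X)).mulVec P.Bu)).sub ((hd.mulVec (P.Kd X)).mulVec P.Bu))
  have hu : IsL2 fun t => -(P.Kx X *ᵥ x t) - P.Kv X *ᵥ v (t + 1) - P.Kd X *ᵥ d t :=
    ((hx.mulVec _).neg.sub (hv1.mulVec _)).sub (hd.mulVec _)
  refine ⟨x, v, _, _, ⟨fun t => ?_, fun t => rfl, fun t => ?_, fun t => rfl, hx.tendsto_atBot,
    hv.tendsto_atTop⟩, hx, hv, (hx.mulVec P.Ce).add (hu.mulVec P.Deu)⟩
  · rw [hx', A11]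
    simp only [Matrix.sub_mulVec, Matrix.mulVec_sub, Matrix.mulVec_neg, ← Matrix.mulVec_mulVec]
    abel
  · rw [hv', Matrix.mulVec_add]

variable {γd γJ : ℝ}

theorem Phat_trajectory_iff {ehat : ℤ → Fin ne ⊕ Fin nd → ℝ} :
    (P.Phat X γd γJ).Trajectory d (fun t => Sum.elim (x t) (v t)) ehat ↔
      (∀ t, x (t + 1) = P.A11 X *ᵥ x t - (P.Bu * P.Kv X * ((P.A11 X)⁻¹)ᵀ) *ᵥ v t + P.Bd *ᵥ d t) ∧
      (∀ t, v (t + 1) = ((P.A11 X)⁻¹)ᵀ *ᵥ v t - (X * P.Bd) *ᵥ d t) ∧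
      ehat = fun t => Sum.elim (γJ • ((P.Ce - P.Deu * P.Kx X) *ᵥ x t -
        (P.Deu * P.Kv X * ((P.A11 X)⁻¹)ᵀ) *ᵥ v t)) (γd • d t) := by
  have h1 : ∀ t, (P.Phat X γd γJ).A *ᵥ Sum.elim (x t) (v t) + (P.Phat X γd γJ).B *ᵥ d t =
      Sum.elim (P.A11 X *ᵥ x t - (P.Bu * P.Kv X * ((P.A11 X)⁻¹)ᵀ) *ᵥ v t + P.Bd *ᵥ d t)
        (((P.A11 X)⁻¹)ᵀ *ᵥ v t - (X * P.Bd) *ᵥ d t) := by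
    intro t
    ext (i | i) <;>
      simp [Phat, Matrix.fromBlocks_mulVec, Matrix.fromRows_mulVec, Matrix.neg_mulVec,
        sub_eq_add_neg]
  have h2 : ∀ t, (P.Phat X γd γJ).C *ᵥ Sum.elim (x t) (v t) + (P.Phat X γd γJ).D *ᵥ d t =
      Sum.elim (γJ • ((P.Ce - P.Deu * P.Kx X) *ᵥ x t -
        (P.Deu * P.Kv X * ((P.A11 X)⁻¹)ᵀ) *ᵥ v t)) (γd • d t) := by
    intro t
    ext (i | i) <;>
      simp [Phat, Matrix.smul_mulVec, Matrix.fromBlocks_mulVec, Matrix.fromRows_mulVec,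
        Matrix.neg_mulVec, sub_eq_add_neg, mul_add]
  simp only [LTI.Trajectory, h1, h2, Sum.elim_eq_iff, forall_and, funext_iff (f := ehat), and_assoc]

/-- Multiplication by `Â₁₁⁻ᵀ` turns the backward recursion into a forward one. Because `K_d = K_v X
B_d`, the preview and feedthrough terms of the control merge into `K_v Â₁₁⁻ᵀ v t`. -/
theorem closedLoop_iff (hA : IsUnit (P.A11 X)) :
    P.ClosedLoop X d x v u e ↔
      (P.Phat X 1 1).Trajectory d (fun t => Sum.elim (x t) (v t)) (fun t => Sum.elim (e t) (d t)) ∧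
      (∀ t, u t = -(P.Kx X *ᵥ x t) - (P.Kv X * ((P.A11 X)⁻¹)ᵀ) *ᵥ v t) ∧
      Tendsto x atBot (𝓝 0) ∧ Tendsto v atTop (𝓝 0) := by
  have h12 : (P.A11 X)ᵀ * ((P.A11 X)⁻¹)ᵀ = 1 := by
    rw [← Matrix.transpose_mul, inv_mul_of_isUnit hA, Matrix.transpose_one]
  have h21 : ((P.A11 X)⁻¹)ᵀ * (P.A11 X)ᵀ = 1 := mul_eq_one_comm.1 h12
  have hKd : P.Kd X = P.Kv X * (X * P.Bd) := by
    rw [Kd, Kv]; simp only [Matrix.mul_assoc]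
  have hcost : (∀ t, v t = (P.A11 X)ᵀ *ᵥ (v (t + 1) + (X * P.Bd) *ᵥ d t)) ↔
      ∀ t, v (t + 1) = ((P.A11 X)⁻¹)ᵀ *ᵥ v t - (X * P.Bd) *ᵥ d t := by
    refine forall_congr' fun t => ⟨fun h => ?_, fun h => ?_⟩
    · rw [h, Matrix.mulVec_mulVec, h21, Matrix.one_mulVec, add_sub_cancel_right]
    · rw [h, sub_add_cancel, Matrix.mulVec_mulVec, h12, Matrix.one_mulVec]
  have hctl : (∀ t, v (t + 1) = ((P.A11 X)⁻¹)ᵀ *ᵥ v t - (X * P.Bd) *ᵥ d t) → ∀ t,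
      -(P.Kx X *ᵥ x t) - P.Kv X *ᵥ v (t + 1) - P.Kd X *ᵥ d t =
        -(P.Kx X *ᵥ x t) - (P.Kv X * ((P.A11 X)⁻¹)ᵀ) *ᵥ v t := by
    intro hv t
    rw [hv, hKd]
    simp only [Matrix.mulVec_sub, ← Matrix.mulVec_mulVec]
    abel
  rw [Phat_trajectory_iff]
  simp only [one_smul, funext_iff (f := fun t => Sum.elim (e t) (d t)), Sum.elim_eq_iff, and_true]
  constructor
  · rintro ⟨hs, he, hc, hu, h0, h1⟩
    have hv := hcost.1 hc
    have hu' : ∀ t, u t = -(P.Kx X *ᵥ x t) - (P.Kv X * ((P.A11 X)⁻¹)ᵀ) *ᵥ v t := fun t => by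
      rw [hu, hctl hv]
    refine ⟨⟨fun t => ?_, hv, fun t => ?_⟩, hu', h0, h1⟩
    · rw [hs, hu', A11]
      simp only [Matrix.sub_mulVec, Matrix.mulVec_sub, Matrix.mulVec_neg, ← Matrix.mulVec_mulVec]
      abel
    · rw [he, hu']
      simp only [Matrix.sub_mulVec, Matrix.mulVec_sub, Matrix.mulVec_neg, ← Matrix.mulVec_mulVec]
      abel
  · rintro ⟨⟨hs, hv, he⟩, hu, h0, h1⟩
    refine ⟨fun t => ?_, fun t => ?_, hcost.2 hv, fun t => by rw [hu, hctl hv], h0, h1⟩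
    · rw [hs, hu, A11]
      simp only [Matrix.sub_mulVec, Matrix.mulVec_sub, Matrix.mulVec_neg, ← Matrix.mulVec_mulVec]
      abel
    · rw [he, hu]
      simp only [Matrix.sub_mulVec, Matrix.mulVec_sub, Matrix.mulVec_neg, ← Matrix.mulVec_mulVec]
      abel

/-- The two-sided output of the augmented system is the augmented error of the closed loop. -/
theorem mapsTwoSided_iff (hX : P.IsStabilizing X) (hA : IsUnit (P.A11 X))
    (h : P.ClosedLoop X d x v u e) (hx : IsL2 x) (hv : IsL2 v) (ehat : ℤ → Fin ne ⊕ Fin nd → ℝ) :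
    (P.Phat X γd γJ).MapsTwoSided d ehat ↔
      ehat = fun t => Sum.elim (γJ • e t) (γd • d t) := by
  have htraj := (Phat_trajectory_iff.1 ((closedLoop_iff hA).1 h).1)
  have he : ∀ t, e t = (P.Ce - P.Deu * P.Kx X) *ᵥ x t -
      (P.Deu * P.Kv X * ((P.A11 X)⁻¹)ᵀ) *ᵥ v t := by
    intro t
    have := congrFun htraj.2.2 t
    rw [one_smul, one_smul, Sum.elim_eq_iff] at this
    exact this.1
  constructor
  · rintro ⟨z, hz, hz0, hz1⟩
    have hzs : z = fun t => Sum.elim (z t ∘ Sum.inl) (z t ∘ Sum.inr) :=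
      funext fun t => (Sum.elim_comp_inl_inr _).symm
    rw [hzs, Phat_trajectory_iff] at hz
    -- Any two-sided state splits into a closed-loop solution, so uniqueness of the loop identifies
    -- it.
    have hcl : P.ClosedLoop X d (fun t => z t ∘ Sum.inl) (fun t => z t ∘ Sum.inr) _ _ :=
      (closedLoop_iff hA).2 ⟨Phat_trajectory_iff.2 ⟨hz.1, hz.2.1, by
          simp only [one_smul]; rfl⟩, fun t => rfl,
        tendsto_pi_nhds.2 fun i => tendsto_pi_nhds.1 hz0 (Sum.inl i),
        tendsto_pi_nhds.2 fun i => tendsto_pi_nhds.1 hz1 (Sum.inr i)⟩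
    obtain ⟨h1, h2, -, -⟩ := h.unique hX hcl
    rw [hz.2.2]
    ext1 t
    have h1t := congrFun h1 t
    have h2t := congrFun h2 t
    rw [h1t, h2t, he]
  · rintro rfl
    refine ⟨fun t => Sum.elim (x t) (v t), Phat_trajectory_iff.2 ⟨htraj.1, htraj.2.1, ?_⟩,
      (hx.elim hv).tendsto_atBot, (hx.elim hv).tendsto_atTop⟩
    ext1 t
    rw [he]

/-- The energy balance of the augmented DARE is summed with storage `x̂ᵀ X̂ x̂`, which is summable
as the whole augmented state is in `ℓ₂`. -/
theorem normSq_mapsTwoSided {V : Matrix (Fin nx) (Fin nx) ℝ} (hγ : 0 < γd) (hXd : X.PosDef)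
    (hZ : IsStabilizingSolution (P.Phat X γd γJ).A (P.Phat X γd γJ).B
      ((P.Phat X γd γJ).Cᵀ * (P.Phat X γd γJ).C) ((P.Phat X γd γJ).Dᵀ * (P.Phat X γd γJ).D)
      ((P.Phat X γd γJ).Cᵀ * (P.Phat X γd γJ).D) (Xhat X V γJ))
    {ehat : ℤ → Fin ne ⊕ Fin nd → ℝ} (hd : IsL2 d) (hx : IsL2 x) (hv : IsL2 v) (he : IsL2 ehat)
    (h : (P.Phat X γd γJ).Trajectory d (fun t => Sum.elim (x t) (v t)) ehat) :
    normSq ehat = ∑' t,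
      (d t - dareGain ((P.A11 X)⁻¹)ᵀ (X * P.Bd) (γd ^ 2 • 1) 0 V *ᵥ v t) ⬝ᵥ
        (γd ^ 2 • 1 + (X * P.Bd)ᵀ * V * (X * P.Bd)) *ᵥ
          (d t - dareGain ((P.A11 X)⁻¹)ᵀ (X * P.Bd) (γd ^ 2 • 1) 0 V *ᵥ v t) := by
  have hR : ((P.Phat X γd γJ).Dᵀ * (P.Phat X γd γJ).D).PosDef := by
    rw [Phat_DD]
    exact posDef_sq_smul_one hγ
  have hxv := hx.elim hv
  have hi := hd.sub (hv.mulVec (dareGain ((P.A11 X)⁻¹)ᵀ (X * P.Bd) (γd ^ 2 • 1) 0 V))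
  refine tsum_eq_of_telescope
    (s := fun t => Sum.elim (x t) (v t) ⬝ᵥ Xhat X V γJ *ᵥ Sum.elim (x t) (v t)) he
    (hi.summable_dotProduct (hi.mulVec _)) (hxv.summable_dotProduct (hxv.mulVec _)) fun t => ?_
  have hb := hZ.energy_balance hR (Sum.elim (x t) (v t)) (d t)
  rw [dareGain_Xhat hXd, Phat_DD, (Xhat_gain hXd).1, ← h.1 t, ← h.2 t, Matrix.fromCols_mulVec,
    Sum.elim_comp_inl, Sum.elim_comp_inr, Matrix.zero_mulVec, zero_add, Matrix.neg_mulVec,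
    ← sub_eq_add_neg] at hb
  exact hb

end Plant

end RegretControl

theorem mainTheorem5 {nx nd nu ne : ℕ} (P : RegretControl.Plant nx nd nu ne) (γd γJ : ℝ)
    (hγd : 0 < γd) (hγJ : 0 ≤ γJ) (hP : P.DAREConditions) :
    -- the DARE has a unique stabilizing solution, and the closed-loop matrix is nonsingular
    (∃! X, P.IsStabilizing X) ∧
    ∀ X, P.IsStabilizing X →
      IsUnit (P.A11 X) ∧
      (RegretControl.Stabilizable ((P.A11 X)⁻¹)ᵀ (X * P.Bd) →
        -- the closed loop with the non-causal controller is well posed; its augmented error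
        -- is the output of the augmented system and has finite norm
        (∀ d, RegretControl.IsL2 d → ∃ x v u e,
          (∀ x' v' u' e', P.ClosedLoop X d x' v' u' e' ↔ x' = x ∧ v' = v ∧ u' = u ∧ e' = e) ∧
          (∀ ehat, (P.Phat X γd γJ).MapsTwoSided d ehat ↔
            ehat = fun t => Sum.elim (γJ • e t) (γd • d t)) ∧
          RegretControl.IsL2 (fun t => Sum.elim (γJ • e t) (γd • d t))) ∧
        -- the spectral factor, with state dimension `nx`, and its inverse
        (∃ F G : RegretControl.LTI (Fin nx) (Fin nd) (Fin nd),
          (∀ d ehat f, RegretControl.IsL2 d → (P.Phat X γd γJ).MapsTwoSided d ehat →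
            F.Maps d f → RegretControl.normSq ehat = RegretControl.normSq f) ∧
          F.IsStable ∧ F.IsL2Operator ∧ F.IsCausal ∧
          F.IsInverse G ∧ G.IsStable ∧ G.IsL2Operator ∧ G.IsCausal) ∧
        -- the structure of the stabilizing solution of the DARE of the augmented system
        X.PosDef ∧
        (∃! V, RegretControl.IsStabilizingSolution ((P.A11 X)⁻¹)ᵀ (X * P.Bd)
          (P.Qtilde X γJ) (γd ^ 2 • 1) 0 V) ∧
        ∀ V, RegretControl.IsStabilizingSolution ((P.A11 X)⁻¹)ᵀ (X * P.Bd)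
            (P.Qtilde X γJ) (γd ^ 2 • 1) 0 V →
          ∀ Z, RegretControl.IsStabilizingSolution (P.Phat X γd γJ).A (P.Phat X γd γJ).B
              ((P.Phat X γd γJ).Cᵀ * (P.Phat X γd γJ).C)
              ((P.Phat X γd γJ).Dᵀ * (P.Phat X γd γJ).D)
              ((P.Phat X γd γJ).Cᵀ * (P.Phat X γd γJ).D) Z ↔
            Z = RegretControl.Xhat X V γJ) := by
  have hR := hP.posDef
  refine ⟨?_, fun X hX => ?_⟩
  · obtain ⟨X, hX⟩ := RegretControl.Plant.exists_isStabilizing hP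
    exact ⟨X, hX, fun Y hY => hY.unique hR hX⟩
  have hA := hX.isUnit_A11 hP
  refine ⟨hA, fun hs => ?_⟩
  have hXd := hX.posDef hR hA hs
  have hγ := RegretControl.Plant.posDef_sq_smul_one (n := nd) hγd
  obtain ⟨V, hV⟩ :=
    RegretControl.Plant.exists_isStabilizingSolution_Qtilde hR hX hA hs hγd γJ
  have hZ := RegretControl.Plant.isStabilizingSolution_Xhat hR hX hXd hA hV
  have hDD : ((P.Phat X γd γJ).Dᵀ * (P.Phat X γd γJ).D).PosDef := by
    rw [RegretControl.Plant.Phat_DD]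
    exact hγ
  refine ⟨fun d hd => ?_, ?_, hXd, ⟨V, hV, fun W hW => hW.unique hγ hV⟩, fun W hW Z => ?_⟩
  · obtain ⟨x, v, u, e, h, hx, hv, he⟩ := RegretControl.Plant.exists_closedLoop hX hd
    refine ⟨x, v, u, e, fun x' v' u' e' => ⟨fun h' => h.unique hX h', ?_⟩,
      RegretControl.Plant.mapsTwoSided_iff hX hA h hx hv, (he.smul γJ).elim (hd.smul γd)⟩
    rintro ⟨rfl, rfl, rfl, rfl⟩
    exact h
  · have h12 : (P.A11 X)ᵀ * ((P.A11 X)⁻¹)ᵀ = 1 := by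
      rw [← Matrix.transpose_mul, RegretControl.inv_mul_of_isUnit hA, Matrix.transpose_one]
    -- The observer is built for the costate, with gain and weight from the `V` equation; the
    -- weighted sum it preserves is the one computed by `normSq_mapsTwoSided`.
    obtain ⟨F, G, hF, hG, hFG, hnorm⟩ := RegretControl.exists_spectral_factor
      (A₁ := P.A11 X) hX.schur h12 hV.schur
      (RegretControl.posDef_innovation (B := X * P.Bd) hγ hV.posSemidef)
    refine ⟨F, G, fun d ehat f hd hehat hf => ?_, hF, hF.isL2Operator, hF.isCausal, hFG, hG,
      hG.isL2Operator, hG.isCausal⟩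
    obtain ⟨x, v, u, e, h, hx, hv, he⟩ := RegretControl.Plant.exists_closedLoop hX hd
    have htraj := RegretControl.Plant.Phat_trajectory_iff.1
      ((RegretControl.Plant.closedLoop_iff hA).1 h).1
    obtain rfl := (RegretControl.Plant.mapsTwoSided_iff hX hA h hx hv ehat).1 hehat
    rw [hnorm d f v hd hf hv htraj.2.1]
    refine RegretControl.Plant.normSq_mapsTwoSided hγd hXd hZ hd hx hv
      ((he.smul γJ).elim (hd.smul γd))
      (RegretControl.Plant.Phat_trajectory_iff.2 ⟨htraj.1, htraj.2.1, ?_⟩)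
    ext1 t
    have := congrFun htraj.2.2 t
    rw [one_smul, one_smul, Sum.elim_eq_iff] at this
    rw [this.1]
  · obtain rfl := hW.unique hγ hV
    refine ⟨fun hZ' => hZ'.unique hDD hZ, ?_⟩
    rintro rfl
    exact hZ
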